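/- Let $Q$ be a finite set of $N$ qubits and let $G$ be an abelian group of multi-qubit Pauli operators with signs $\pm$ such that $-1\notin G$, having (up to scalars) a unique simultaneous $+1$ eigenvector; let $|\psi\rangle$ be this state, normalized. Let $A_1,A_2\subseteq Q$ be disjoint, $A=A_1\cup A_2$. For $S\subseteq Q$ let $\rho_S$ be the reduced density matrix of $|\psi\rangle$ on $S$, let $G_S\subseteq G$ be the subgroup of stabilizers supported inside $S$, and let $p_S(g)$ denote the restriction of a stabilizer $g$ to $S$ (the Hermitian Pauli operator, defined up to a sign, that agrees with $g$ on the sites of $S$ and is the identity elsewhere). All logarithms have base $2$. Put $S^{(m)}_S=(1-m)^{-1}\log\operatorname{Tr}\rho_S^m$ for real $m\ge 0$, $m\neq 1$ (powers being taken on the support of $\rho_S$, so $S^{(0)}_S=\log\operatorname{rank}\rho_S$), $S^{(1)}_S=-\operatorname{Tr}\rho_S\log\rho_S$, $I^{(m)}(A_1,A_2)=S^{(m)}_{A_1}+S^{(m)}_{A_2}-S^{(m)}_{A}$, and $\mathcal E_{\rm PT}(A_1,A_2)=\log\|\rho_A^{T_2}\|_1$, where $T_2$ is the partial transpose on $A_2$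 and $\|M\|_1=\operatorname{Tr}\sqrt{M^\dagger M}$. There is a subgroup $G_{12}$ with $G_A=G_{A_1}G_{A_2}G_{12}$ and $G_{12}\cap G_{A_1}G_{A_2}=\{1\}$, and every such $G_{12}$ has canonical generators, i.e. independent generators $$G_{12}=\langle z_1,\dots,z_r,w_1,\dots,w_s,\bar w_1,\dots,\bar w_s\rangle$$ such that each $p_{A_2}(z_i)$ commutes with all these generators, each $p_{A_2}(w_j)$ commutes with all of them except $\bar w_j$, and each $p_{A_2}(\bar w_j)$ commutes with all of them except $w_j$. For every such $G_{12}$ and every choice of canonical generators of it, $$\mathcal E_{\rm PT}(A_1,A_2)=s=\tfrac12\bigl[I^{(m)}(A_1,A_2)-r\bigr]\qquad\text{for every real } m\ge 0 .$$ -/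

import Mathlib

open scoped Kronecker

noncomputable section

/-- Computational-basis labels of a register of qubits indexed by `Q`. -/
abbrev QBasis (Q : Type*) : Type _ := Q → Fin 2

/-- Operators on the Hilbert space of the qubits in `Q`, as matrices in the computational basis. -/
abbrev QOp (Q : Type*) : Type _ := Matrix (QBasis Q) (QBasis Q) ℂ

/-- The four single-qubit Pauli labels. -/
inductive Pauli : Type
  | I
  | X
  | Y
  | Z

/-- The single-qubit Pauli matrices. -/
def Pauli.mat : Pauli → Matrix (Fin 2) (Fin 2) ℂ
  | Pauli.I => !![1, 0; 0, 1]
  | Pauli.X => !![0, 1; 1, 0]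
  | Pauli.Y => !![0, -Complex.I; Complex.I, 0]
  | Pauli.Z => !![1, 0; 0, -1]

/-- The multi-site Pauli operator `⨂_q σ_{p q}`. -/
def pauliString {Q : Type*} [Fintype Q] (p : Q → Pauli) : QOp Q :=
  Matrix.of fun x y => ∏ q, (p q).mat (x q) (y q)

/-- `g` is the Pauli operator with labels `p`, up to a sign. -/
def EqUpToSign {Q : Type*} [Fintype Q] (g : QOp Q) (p : Q → Pauli) : Prop :=
  g = pauliString p ∨ g = -pauliString p

open Classical in
/-- The Pauli labels of a signed Pauli operator (all `I` for any other operator). -/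
def pauliLabel {Q : Type*} [Fintype Q] (g : QOp Q) : Q → Pauli :=
  if h : ∃ p, EqUpToSign g p then h.choose else fun _ => Pauli.I

theorem trace_pauliString_mul {Q : Type*} [Fintype Q] [DecidableEq Q] (p p' : Q → Pauli) :
    (pauliString p * pauliString p').trace = ∏ q, ((p q).mat * (p' q).mat).trace := by
  simp only [Matrix.trace, Matrix.diag, Matrix.mul_apply, pauliString, Matrix.of_apply]
  rw [Finset.prod_univ_sum, Fintype.piFinset_univ]
  refine Finset.sum_congr rfl fun x _ => ?_
  rw [Finset.prod_univ_sum, Fintype.piFinset_univ]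
  refine Finset.sum_congr rfl fun y _ => ?_
  rw [Finset.prod_mul_distrib]

theorem Pauli.trace_mul_ne_zero_iff (a b : Pauli) : (a.mat * b.mat).trace ≠ 0 ↔ a = b := by
  cases a <;> cases b <;>
    simp [Pauli.mat, Matrix.trace_fin_two]

/-- The labels of a signed Pauli operator are unique, so `pauliLabel` is well defined. -/
theorem pauliLabel_eq {Q : Type*} [Fintype Q] {g : QOp Q} {p : Q → Pauli}
    (h : EqUpToSign g p) : pauliLabel g = p := by
  classical
  have hex : ∃ p, EqUpToSign g p := ⟨p, h⟩
  have key : ∀ p' : Q → Pauli, EqUpToSign g p' → p' = p := by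
    intro p' h'
    have hne : (pauliString p * pauliString p).trace ≠ 0 := by
      rw [trace_pauliString_mul]
      exact Finset.prod_ne_zero_iff.2 fun q _ => (Pauli.trace_mul_ne_zero_iff _ _).2 rfl
    have hne' : (pauliString p' * pauliString p).trace ≠ 0 := by
      intro h0
      apply hne
      rcases h with h | h <;> rcases h' with h' | h'
      · rwa [← h', h] at h0
      · have e : pauliString p' = -pauliString p := by rw [← h, h', neg_neg]
        rw [e, Matrix.neg_mul, Matrix.trace_neg, neg_eq_zero] at h0
        exact h0
      · have e : pauliString p' = -pauliString p := by rw [← h', h]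
        rw [e, Matrix.neg_mul, Matrix.trace_neg, neg_eq_zero] at h0
        exact h0
      · have e : pauliString p' = pauliString p := neg_injective (by rw [← h', h])
        rwa [e] at h0
    rw [trace_pauliString_mul] at hne'
    funext q
    exact (Pauli.trace_mul_ne_zero_iff _ _).1
      (Finset.prod_ne_zero_iff.1 hne' q (Finset.mem_univ q))
  unfold pauliLabel
  rw [dif_pos hex]
  exact key _ hex.choose_spec

section
variable {Q : Type*} [Fintype Q] [DecidableEq Q]

/-- The restriction `p_S(g)` of a signed Pauli operator `g` to the qubits in `S`: the Hermitian
Pauli operator that agrees with `g` on the sites of `S` and is the identity elsewhere. It is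
determined by `g` up to a sign; the sign `+` is chosen. -/
def pauliRestrict (S : Finset Q) (g : QOp Q) : QOp Q :=
  pauliString fun q => if q ∈ S then pauliLabel g q else Pauli.I

/-- The splitting of basis labels into the sites of `S` and the sites outside `S`. -/
def splitBasis (S : Finset Q) :
    QBasis Q ≃ QBasis {q // q ∈ S} × QBasis {q // q ∉ S} :=
  Equiv.piEquivPiSubtypeProd (fun q => q ∈ S) (fun _ => Fin 2)

/-- `M ↦ M ⊗ 1`, from operators on the qubits in `S` to operators on all the qubits. -/
def embedOp (S : Finset Q) : QOp {q // q ∈ S} →* QOp Q where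
  toFun M := Matrix.reindex (splitBasis S).symm (splitBasis S).symm
    (M ⊗ₖ (1 : QOp {q // q ∉ S}))
  map_one' := by simp
  map_mul' M N := by
    simp only [Matrix.reindex_apply, Equiv.symm_symm]
    rw [Matrix.submatrix_mul_equiv, ← Matrix.mul_kronecker_mul, Matrix.one_mul]

/-- The partial trace over the qubits outside `S`. -/
def partialTrace (S : Finset Q) (M : QOp Q) : QOp {q // q ∈ S} :=
  Matrix.of fun x y => ∑ z : QBasis {q // q ∉ S},
    M ((splitBasis S).symm (x, z)) ((splitBasis S).symm (y, z))

/-- The reduced density matrix `ρ_S` of the pure state `ψ`. -/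
def reducedDensity (S : Finset Q) (ψ : QBasis Q → ℂ) : QOp {q // q ∈ S} :=
  partialTrace S (Matrix.vecMulVec ψ (star ψ))

/-- The partial transpose, over the qubits in `T`, of an operator on the qubits in `S`: the row and
column labels of the sites in `T` are exchanged. -/
def partialTranspose (S T : Finset Q) (M : QOp {q // q ∈ S}) : QOp {q // q ∈ S} :=
  Matrix.of fun x y =>
    M (fun q => if q.1 ∈ T then y q else x q) (fun q => if q.1 ∈ T then x q else y q)

end

/-- The trace norm `‖M‖₁ = Tr √(Mᴴ M)`. -/
def traceNorm {n : Type*} [Fintype n] [DecidableEq n] (M : Matrix n n ℂ) : ℝ :=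
  (cfc Real.sqrt (M.conjTranspose * M)).trace.re

/-- The Rényi entropy, in bits, of a density matrix `ρ`:
`(1 - m)⁻¹ log₂ Tr ρ^m` for `m ≠ 1`, and the von Neumann entropy `-Tr ρ log₂ ρ` for `m = 1`.
The power is taken on the support of `ρ`, so that the index `m = 0` gives `log₂ (rank ρ)`. -/
def renyiEntropy {n : Type*} [Fintype n] [DecidableEq n] (m : ℝ) (ρ : Matrix n n ℂ) : ℝ :=
  if m = 1 then -(cfc (fun t : ℝ => t * Real.logb 2 t) ρ).trace.re
  else (1 - m)⁻¹ *
    Real.logb 2 (cfc (fun t : ℝ => if t = 0 then 0 else t ^ m) ρ).trace.re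

section
variable {Q : Type*} [Fintype Q] [DecidableEq Q]

/-- The Rényi mutual information `I^(m)(A₁, A₂)` of the pure state `ψ`. -/
def mutualInfo (m : ℝ) (A₁ A₂ : Finset Q) (ψ : QBasis Q → ℂ) : ℝ :=
  renyiEntropy m (reducedDensity A₁ ψ) + renyiEntropy m (reducedDensity A₂ ψ)
    - renyiEntropy m (reducedDensity (A₁ ∪ A₂) ψ)

/-- The partial-transpose negativity `log₂ ‖ρ_A^{T₂}‖₁`, with `A = A₁ ∪ A₂`. -/
def ptNegativity (A₁ A₂ : Finset Q) (ψ : QBasis Q → ℂ) : ℝ :=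
  Real.logb 2
    (traceNorm (partialTranspose (A₁ ∪ A₂) A₂ (reducedDensity (A₁ ∪ A₂) ψ)))

/-- An abelian group of Pauli operators with signs `±` that does not contain `-1`. -/
structure IsStabilizerGroup (G : Subgroup (QOp Q)ˣ) : Prop where
  signedPauli : ∀ g ∈ G, ∃ p, EqUpToSign (g : QOp Q) p
  comm : ∀ g ∈ G, ∀ h ∈ G, g * h = h * g
  neg_one_notMem : (-1 : (QOp Q)ˣ) ∉ G

/-- `ψ` is a unit vector and is, up to scalars, the unique simultaneous `+1` eigenvector of the
elements of `G`. -/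
structure IsStabilizerState (G : Subgroup (QOp Q)ˣ) (ψ : QBasis Q → ℂ) : Prop where
  norm_one : ∑ x, ‖ψ x‖ ^ 2 = 1
  fixed : ∀ g ∈ G, (g : QOp Q).mulVec ψ = ψ
  unique : ∀ φ : QBasis Q → ℂ, (∀ g ∈ G, (g : QOp Q).mulVec φ = φ) → ∃ c : ℂ, φ = c • ψ

/-- `G_S`: the subgroup of the stabilizers that lie inside `S`, i.e. are of the form `U ⊗ 1` with
`U` acting on the qubits in `S`. -/
def localStabilizers (G : Subgroup (QOp Q)ˣ) (S : Finset Q) : Subgroup (QOp Q)ˣ :=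
  G ⊓ (Units.map (embedOp S)).range

/-- `G₁₂` completes `G_{A₁}` and `G_{A₂}` to `G_A`, `A = A₁ ∪ A₂`: one has
`G_A = G_{A₁} G_{A₂} G₁₂`, and `G₁₂` is independent of `G_{A₁} G_{A₂}`. -/
structure IsCrossSubgroup (G : Subgroup (QOp Q)ˣ) (A₁ A₂ : Finset Q)
    (G₁₂ : Subgroup (QOp Q)ˣ) : Prop where
  generate : localStabilizers G A₁ ⊔ localStabilizers G A₂ ⊔ G₁₂ = localStabilizers G (A₁ ∪ A₂)
  independent : Disjoint (localStabilizers G A₁ ⊔ localStabilizers G A₂) G₁₂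

/-- `z₁, …, z_r, w₁, …, w_s, w̄₁, …, w̄_s` are canonical generators of `G₁₂` with respect to
restriction to `A₂`. The generators are independent: `G₁₂` has rank `r + 2 s`. -/
structure IsCanonicalGenerators (A₂ : Finset Q) (G₁₂ : Subgroup (QOp Q)ˣ) {r s : ℕ}
    (z : Fin r → (QOp Q)ˣ) (w wbar : Fin s → (QOp Q)ˣ) : Prop where
  generate : Subgroup.closure (Set.range z ∪ Set.range w ∪ Set.range wbar) = G₁₂
  independent : Nat.card G₁₂ = 2 ^ (r + 2 * s)
  z_comm : ∀ i, ∀ g ∈ Set.range z ∪ Set.range w ∪ Set.range wbar,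
    Commute (pauliRestrict A₂ (z i : QOp Q)) (g : QOp Q)
  w_comm : ∀ j, ∀ g ∈ Set.range z ∪ Set.range w ∪ Set.range wbar,
    Commute (pauliRestrict A₂ (w j : QOp Q)) (g : QOp Q) ↔ g ≠ wbar j
  wbar_comm : ∀ j, ∀ g ∈ Set.range z ∪ Set.range w ∪ Set.range wbar,
    Commute (pauliRestrict A₂ (wbar j : QOp Q)) (g : QOp Q) ↔ g ≠ w j

end

end

/-! The projector onto `ψ` is `2⁻ᴺ ∑ g` over `G` (`IsStabilizerState.signedSum_eq`). Tracing out the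
complement of `S` kills every stabilizer that reaches outside `S`, so `ρ_S = 2^(-|S|) ∑ g` over
`G_S`. This is a multiple of a projection, and all its Rényi entropies equal `|S| - log |G_S|`
(`IsStabilizerState.renyiEntropy_eq`). Since `|G_A| = |G_{A₁}| |G_{A₂}| 2^(r+2s)`, the mutual
information is `r + 2s`.

Partial transposition multiplies a Pauli string `g` by a sign `t g`, the parity of its `Y`'s on
`A₂`. Because transposition reverses products, `t (g h) = t g * t h * ε g h`, where `ε` is the
commutation sign of the restrictions to `A₂`. Squaring `∑ t g • g` over `G_A` therefore produces the
character sums `∑ ε g k` over `g`, which vanish unless `k` lies in the radical `R` of `ε`; the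
square is `|G_A| ∑ t k • k` over `R` (`signedSum_mul_signedSum`). On `R` the sign `t` is a
character, so this is again a multiple of a projection, and the trace norm comes out as `√(|G_A| /
|R|)`.

The subgroups `G_{A₁}`, `G_{A₂}` and the `z i` lie in the radical, while the pairs `w j`, `wbar j`
are hyperbolic, so `R` has index `2^(2s)` (`exists_radical`) and the trace norm is `2^s`. Existence
of `G₁₂` and of canonical generators is linear algebra over the field with two elements: complements
(`exists_disjoint_sup_eq`) and symplectic bases (`exists_symplectic_generators`). -/

/-! ### Single-qubit Pauli matrices: products, commutation signs, transposition signs. -/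

/-- The product of Pauli labels, phases being dropped. -/
def Pauli.mulLabel : Pauli → Pauli → Pauli
  | Pauli.I, b => b
  | a, Pauli.I => a
  | Pauli.X, Pauli.X => Pauli.I
  | Pauli.X, Pauli.Y => Pauli.Z
  | Pauli.X, Pauli.Z => Pauli.Y
  | Pauli.Y, Pauli.X => Pauli.Z
  | Pauli.Y, Pauli.Y => Pauli.I
  | Pauli.Y, Pauli.Z => Pauli.X
  | Pauli.Z, Pauli.X => Pauli.Y
  | Pauli.Z, Pauli.Y => Pauli.X
  | Pauli.Z, Pauli.Z => Pauli.I

/-- The sign `c` with `a b = c b a` for single-qubit Pauli matrices. -/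
def Pauli.commSign : Pauli → Pauli → ℤˣ
  | Pauli.I, _ => 1
  | _, Pauli.I => 1
  | Pauli.X, Pauli.X => 1
  | Pauli.Y, Pauli.Y => 1
  | Pauli.Z, Pauli.Z => 1
  | _, _ => -1

/-- The sign of a single-qubit Pauli matrix under transposition. -/
def Pauli.transposeSign : Pauli → ℤˣ
  | Pauli.Y => -1
  | _ => 1

theorem Pauli.exists_mat_mul (a b : Pauli) :
    ∃ c : ℂ, a.mat * b.mat = c • (a.mulLabel b).mat := by
  cases a <;> cases b <;>
  first
  | (refine ⟨1, ?_⟩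
     ext i j; fin_cases i <;> fin_cases j <;> simp [Pauli.mat, Pauli.mulLabel] <;> done)
  | (refine ⟨Complex.I, ?_⟩
     ext i j; fin_cases i <;> fin_cases j <;> simp [Pauli.mat, Pauli.mulLabel] <;> done)
  | (refine ⟨-Complex.I, ?_⟩
     ext i j; fin_cases i <;> fin_cases j <;> simp [Pauli.mat, Pauli.mulLabel])

theorem Pauli.mat_mul_comm (a b : Pauli) :
    a.mat * b.mat = ((a.commSign b : ℤ) : ℂ) • (b.mat * a.mat) := by
  cases a <;> cases b <;> ext i j <;> fin_cases i <;> fin_cases j <;>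
    simp [Pauli.mat, Pauli.commSign]

theorem Pauli.mat_mul_self (a : Pauli) : a.mat * a.mat = 1 := by
  cases a <;> ext i j <;> fin_cases i <;> fin_cases j <;> simp [Pauli.mat]

theorem Pauli.star_mat_apply (a : Pauli) (i j : Fin 2) : star (a.mat j i) = a.mat i j := by
  cases a <;> fin_cases i <;> fin_cases j <;> simp [Pauli.mat]

theorem Pauli.mat_swap_apply (a : Pauli) (i j : Fin 2) :
    a.mat j i = ((a.transposeSign : ℤ) : ℂ) * a.mat i j := by
  cases a <;> fin_cases i <;> fin_cases j <;> simp [Pauli.mat, Pauli.transposeSign]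

theorem Pauli.mat_I : Pauli.I.mat = 1 := by
  ext i j; fin_cases i <;> fin_cases j <;> simp [Pauli.mat]

theorem Pauli.trace_mat_eq_zero {a : Pauli} (h : a ≠ Pauli.I) : a.mat.trace = 0 := by
  cases a <;> simp_all [Pauli.mat, Matrix.trace_fin_two]

theorem Pauli.commSign_mulLabel_left (a b d : Pauli) :
    (a.mulLabel b).commSign d = a.commSign d * b.commSign d := by
  cases a <;> cases b <;> cases d <;> rfl

theorem Pauli.commSign_symm (a b : Pauli) : a.commSign b = b.commSign a := by
  cases a <;> cases b <;> rfl

theorem Pauli.commSign_self (a : Pauli) : a.commSign a = 1 := by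
  cases a <;> rfl

theorem Pauli.commSign_I_left (a : Pauli) : Pauli.I.commSign a = 1 := by
  cases a <;> rfl

/-- From `(a b)ᵀ = bᵀ aᵀ`: reordering the two factors costs the commutation sign. This defect of
multiplicativity is the source of the negativity. -/
theorem Pauli.transposeSign_mulLabel (a b : Pauli) :
    (a.mulLabel b).transposeSign = a.transposeSign * b.transposeSign * a.commSign b := by
  cases a <;> cases b <;> rfl

/-! ### Tensor products of single-qubit operators and Pauli strings. -/

section TensorProduct
variable {Q : Type*} [Fintype Q]

/-- The tensor product of single-qubit operators. -/
noncomputable def tensorOp (M : Q → Matrix (Fin 2) (Fin 2) ℂ) : QOp Q :=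
  Matrix.of fun x y => ∏ q, M q (x q) (y q)

theorem pauliString_eq_tensorOp (p : Q → Pauli) : pauliString p = tensorOp fun q => (p q).mat :=
  rfl

theorem tensorOp_mul [DecidableEq Q] (M N : Q → Matrix (Fin 2) (Fin 2) ℂ) :
    tensorOp M * tensorOp N = tensorOp fun q => M q * N q := by
  ext x y
  simp only [tensorOp, Matrix.mul_apply, Matrix.of_apply]
  rw [Finset.prod_univ_sum, Fintype.piFinset_univ]
  simp only [Finset.prod_mul_distrib]

theorem tensorOp_smul (c : Q → ℂ) (M : Q → Matrix (Fin 2) (Fin 2) ℂ) :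
    tensorOp (fun q => c q • M q) = (∏ q, c q) • tensorOp M := by
  ext x y
  simp [tensorOp, Finset.prod_mul_distrib]

theorem tensorOp_one : tensorOp (fun _ : Q => 1) = 1 := by
  ext x y
  simp only [tensorOp, Matrix.of_apply, Matrix.one_apply]
  by_cases h : x = y
  · simp [h]
  · obtain ⟨q, hq⟩ := Function.ne_iff.1 h
    rw [if_neg h]
    exact Finset.prod_eq_zero (Finset.mem_univ q) (if_neg hq)

theorem trace_tensorOp [DecidableEq Q] (M : Q → Matrix (Fin 2) (Fin 2) ℂ) :
    (tensorOp M).trace = ∏ q, (M q).trace := by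
  simp only [tensorOp, Matrix.trace, Matrix.diag, Matrix.of_apply]
  rw [Finset.prod_univ_sum, Fintype.piFinset_univ]

theorem pauliString_mul_self [DecidableEq Q] (p : Q → Pauli) :
    pauliString p * pauliString p = 1 := by
  simp only [pauliString_eq_tensorOp, tensorOp_mul, Pauli.mat_mul_self, tensorOp_one]

theorem exists_pauliString_mul [DecidableEq Q] (p p' : Q → Pauli) :
    ∃ c : ℂ, pauliString p * pauliString p' = c • pauliString fun q => (p q).mulLabel (p' q) := by
  choose c hc using fun q => (p q).exists_mat_mul (p' q)
  exact ⟨∏ q, c q, by simp only [pauliString_eq_tensorOp, tensorOp_mul, hc, tensorOp_smul]⟩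

theorem pauliString_mul_comm [DecidableEq Q] (p p' : Q → Pauli) :
    pauliString p * pauliString p' =
      (((∏ q, (p q).commSign (p' q) : ℤˣ) : ℤ) : ℂ) • (pauliString p' * pauliString p) := by
  simp only [pauliString_eq_tensorOp, tensorOp_mul]
  simp only [fun q => (p q).mat_mul_comm (p' q), tensorOp_smul]
  push_cast
  rfl

theorem pauliString_I : pauliString (fun _ : Q => Pauli.I) = 1 := by
  simp only [pauliString_eq_tensorOp, Pauli.mat_I, tensorOp_one]

theorem pauliString_conjTranspose (p : Q → Pauli) : (pauliString p).conjTranspose = pauliString p := by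
  ext x y
  simp only [pauliString, Matrix.conjTranspose_apply, Matrix.of_apply, star_prod,
    Pauli.star_mat_apply]

theorem trace_pauliString_eq_zero [DecidableEq Q] {p : Q → Pauli} {q : Q} (h : p q ≠ Pauli.I) :
    (pauliString p).trace = 0 := by
  rw [pauliString_eq_tensorOp, trace_tensorOp]
  exact Finset.prod_eq_zero (Finset.mem_univ q) (Pauli.trace_mat_eq_zero h)

/-- Proportional Pauli operators have the same labels. -/
theorem pauliString_label_unique [DecidableEq Q] {p p' : Q → Pauli} {c : ℂ}
    (h : pauliString p = c • pauliString p') : p = p' := by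
  have h1 : (pauliString p * pauliString p).trace ≠ 0 := by
    rw [trace_pauliString_mul]
    exact Finset.prod_ne_zero_iff.2 fun q _ => (Pauli.trace_mul_ne_zero_iff _ _).2 rfl
  nth_rewrite 1 [h] at h1
  rw [Matrix.smul_mul, Matrix.trace_smul, trace_pauliString_mul] at h1
  have h2 := right_ne_zero_of_smul h1
  funext q
  exact ((Pauli.trace_mul_ne_zero_iff _ _).1 (Finset.prod_ne_zero_iff.1 h2 q (Finset.mem_univ q))).symm

end TensorProduct

/-! ### Pauli strings up to sign. -/

section SignedPauli
variable {Q : Type*} [Fintype Q]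

theorem EqUpToSign.eq_or {g : QOp Q} {p : Q → Pauli} (h : EqUpToSign g p) :
    g = pauliString (pauliLabel g) ∨ g = -pauliString (pauliLabel g) := by
  rwa [pauliLabel_eq h]

theorem EqUpToSign.mul_self [DecidableEq Q] {g : QOp Q} {p : Q → Pauli} (h : EqUpToSign g p) :
    g * g = 1 := by
  rcases h with h | h <;> simp [h, pauliString_mul_self]

theorem EqUpToSign.conjTranspose {g : QOp Q} {p : Q → Pauli} (h : EqUpToSign g p) :
    g.conjTranspose = g := by
  rcases h with h | h <;> simp [h, pauliString_conjTranspose]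

theorem EqUpToSign.exists_sign {g : QOp Q} {p : Q → Pauli} (h : EqUpToSign g p) :
    ∃ c : ℂ, c ≠ 0 ∧ g = c • pauliString p := by
  rcases h with h | h
  · exact ⟨1, one_ne_zero, by simp [h]⟩
  · exact ⟨-1, by simp, by simp [h]⟩

/-- The phase of the product need not be tracked, because proportional Pauli strings have equal
labels. -/
theorem EqUpToSign.label_mul [DecidableEq Q] {g h : QOp Q} {p p' p'' : Q → Pauli}
    (hg : EqUpToSign g p) (hh : EqUpToSign h p') (hgh : EqUpToSign (g * h) p'') :
    p'' = fun q => (p q).mulLabel (p' q) := by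
  obtain ⟨a, -, rfl⟩ := hg.exists_sign
  obtain ⟨b, -, rfl⟩ := hh.exists_sign
  obtain ⟨c, hc, e⟩ := hgh.exists_sign
  obtain ⟨d, hd⟩ := exists_pauliString_mul p p'
  rw [Matrix.smul_mul, Matrix.mul_smul, hd] at e
  refine pauliString_label_unique (c := c⁻¹ * (a * b * d)) ?_
  rw [mul_smul, mul_smul, mul_smul, e, smul_smul, inv_mul_cancel₀ hc, one_smul]

end SignedPauli

/-! ### Entropy and trace norm when the spectrum is flat. -/

section FunctionalCalculus
variable {n : Type*} [Fintype n] [DecidableEq n]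

/-- The functional calculus of a multiple of an orthogonal projection. -/
theorem cfc_smul_projection {P : Matrix n n ℂ} (hP : P * P = P) (hP' : P.IsHermitian)
    {f : ℝ → ℝ} (hf : f 0 = 0) (c : ℝ) : cfc f (c • P) = f c • P := by
  have hsa : IsSelfAdjoint P := hP'
  have hid : IsIdempotentElem P := hP
  have hfin : (spectrum ℝ P).Finite := hid.finite_spectrum ℝ
  rw [← cfc_comp_const_mul c f P ((hfin.image _).continuousOn f)]
  -- The spectrum of `P` lies in `{0, 1}`, where `f (c * x)` and `f c * x` agree because `f 0 = 0`.
  rw [cfc_congr (g := fun x => f c * x), cfc_const_mul_id (f c) P hsa]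
  intro x hx
  rcases hid.spectrum_subset ℝ hx with rfl | rfl <;> simp [hf]

/-- The trace hypothesis normalizes `c • P`. Then the trace of its `m`-th power is `c^(m-1)`, and
the prefactor `(1 - m)⁻¹` removes the dependence on `m`. Setting the power to `0` at `0` makes this
valid for `m = 0` too. -/
theorem renyiEntropy_smul_projection {P : Matrix n n ℂ} (hP : P * P = P) (hP' : P.IsHermitian)
    {c : ℝ} (hc : 0 < c) (htr : P.trace = ((c⁻¹ : ℝ) : ℂ)) (m : ℝ) :
    renyiEntropy m (c • P) = -Real.logb 2 c := by
  unfold renyiEntropy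
  split_ifs with hm
  · rw [cfc_smul_projection hP hP' (by simp), Matrix.trace_smul, htr, Complex.real_smul,
      ← Complex.ofReal_mul, Complex.ofReal_re]
    field_simp
  · rw [cfc_smul_projection hP hP' (by simp), Matrix.trace_smul, htr, Complex.real_smul,
      ← Complex.ofReal_mul, Complex.ofReal_re, if_neg hc.ne', 
      ← Real.rpow_neg_one c, ← Real.rpow_add hc, Real.logb_rpow_eq_mul_logb_of_pos hc]
    have : 1 - m ≠ 0 := sub_ne_zero.2 (Ne.symm hm)
    field_simp
    ring

theorem traceNorm_eq_of_conjTranspose_mul {M P : Matrix n n ℂ} (hP : P * P = P)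
    (hP' : P.IsHermitian) {c : ℝ} (hc : 0 ≤ c) (hM : M.conjTranspose * M = (c ^ 2) • P) :
    traceNorm M = c * P.trace.re := by
  unfold traceNorm
  rw [hM, cfc_smul_projection hP hP' (by simp), Matrix.trace_smul, Real.sqrt_sq hc,
    Complex.real_smul, Complex.re_ofReal_mul]

end FunctionalCalculus

instance : Finite Pauli :=
  Finite.of_injective (fun a : Pauli => match a with
    | Pauli.I => (0 : Fin 4)
    | Pauli.X => 1
    | Pauli.Y => 2
    | Pauli.Z => 3) (by intro a b; cases a <;> cases b <;> simp)

/-! ### Commutation and transposition signs, and signed sums over stabilizer groups. -/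

section Signs
variable {Q : Type*} [Fintype Q] [DecidableEq Q]

/-- The sign by which the restrictions of `g` and `h` to `S` commute or anticommute. -/
noncomputable def commSignOn (S : Finset Q) (g h : (QOp Q)ˣ) : ℤˣ :=
  ∏ q ∈ S, (pauliLabel (g : QOp Q) q).commSign (pauliLabel (h : QOp Q) q)

/-- The sign of `g` under partial transposition on `S`. -/
noncomputable def transposeSignOn (S : Finset Q) (g : (QOp Q)ˣ) : ℤˣ :=
  ∏ q ∈ S, (pauliLabel (g : QOp Q) q).transposeSign

theorem commSignOn_symm (S : Finset Q) (g h : (QOp Q)ˣ) :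
    commSignOn S g h = commSignOn S h g :=
  Finset.prod_congr rfl fun _ _ => Pauli.commSign_symm _ _

theorem commSignOn_self (S : Finset Q) (g : (QOp Q)ˣ) : commSignOn S g g = 1 :=
  Finset.prod_eq_one fun _ _ => Pauli.commSign_self _

theorem commute_iff_of_mul_eq_sign_smul {R : Type*} [Ring R] [Module ℂ R] {a b : R} {u : ℤˣ}
    (h : a * b = ((u : ℤ) : ℂ) • (b * a)) (h0 : b * a ≠ 0) : Commute a b ↔ u = 1 := by
  rcases Int.units_eq_one_or u with rfl | rfl
  · simpa [Commute, SemiconjBy] using h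
  · simp only [Commute, SemiconjBy, h]
    constructor
    · intro h1
      have h2 : (2 : ℂ) • (b * a) = 0 := by
        rw [two_smul]
        nth_rewrite 1 [← h1]
        simp
      exact absurd ((smul_eq_zero.1 h2).resolve_left two_ne_zero) h0
    · intro h1
      exact absurd h1 (by decide)

theorem mul_ne_zero_of_isUnit {R : Type*} [Ring R] [Nontrivial R] {a b : R} (ha : IsUnit a)
    (hb : IsUnit b) : a * b ≠ 0 := (ha.mul hb).ne_zero

theorem pauliString_isUnit (p : Q → Pauli) : IsUnit (pauliString p) :=
  IsUnit.of_mul_eq_one _ (pauliString_mul_self p)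

/-- The restriction is the identity off `S`, so only sites of `S` contribute to the commutation
sign, and the overall sign of `h` cancels. -/
theorem commute_pauliRestrict_iff (S : Finset Q) (g h : (QOp Q)ˣ) {p : Q → Pauli}
    (hh : EqUpToSign (h : QOp Q) p) :
    Commute (pauliRestrict S (g : QOp Q)) (h : QOp Q) ↔ commSignOn S g h = 1 := by
  refine commute_iff_of_mul_eq_sign_smul ?_
    (mul_ne_zero_of_isUnit h.isUnit (pauliString_isUnit _))
  have key := pauliString_mul_comm
    (fun q => if q ∈ S then pauliLabel (g : QOp Q) q else Pauli.I) (pauliLabel (h : QOp Q))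
  have hprod : ∏ q, (if q ∈ S then pauliLabel (g : QOp Q) q else Pauli.I).commSign
      (pauliLabel (h : QOp Q) q) = commSignOn S g h := by
    unfold commSignOn
    rw [← Finset.prod_subset (Finset.subset_univ S)]
    · exact Finset.prod_congr rfl fun q hq => by rw [if_pos hq]
    · intro q _ hq
      rw [if_neg hq, Pauli.commSign_I_left]
  rw [hprod] at key
  unfold pauliRestrict
  rcases hh.eq_or with e | e <;> rw [e]
  · exact key
  · rw [Matrix.mul_neg, key, Matrix.neg_mul, smul_neg]

namespace IsStabilizerGroup
variable {G : Subgroup (QOp Q)ˣ} (hG : IsStabilizerGroup G)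
include hG

theorem mono {H : Subgroup (QOp Q)ˣ} (h : H ≤ G) : IsStabilizerGroup H :=
  ⟨fun g hg => hG.signedPauli g (h hg), fun g hg k hk => hG.comm g (h hg) k (h hk),
    fun h1 => hG.neg_one_notMem (h h1)⟩

theorem mul_self {g : (QOp Q)ˣ} (hg : g ∈ G) : g * g = 1 := by
  obtain ⟨p, hp⟩ := hG.signedPauli g hg
  exact Units.ext hp.mul_self

theorem label_mul {g h : (QOp Q)ˣ} (hg : g ∈ G) (hh : h ∈ G) (q : Q) :
    pauliLabel ((g * h : (QOp Q)ˣ) : QOp Q) q =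
      (pauliLabel (g : QOp Q) q).mulLabel (pauliLabel (h : QOp Q) q) := by
  obtain ⟨p, hp⟩ := hG.signedPauli g hg
  obtain ⟨p', hp'⟩ := hG.signedPauli h hh
  obtain ⟨p'', hp''⟩ := hG.signedPauli _ (G.mul_mem hg hh)
  rw [pauliLabel_eq hp, pauliLabel_eq hp', pauliLabel_eq hp'']
  rw [Units.val_mul] at hp''
  exact congrFun (hp.label_mul hp' hp'') q

theorem commSignOn_mul_left (S : Finset Q) {g h : (QOp Q)ˣ} (hg : g ∈ G) (hh : h ∈ G)
    (k : (QOp Q)ˣ) : commSignOn S (g * h) k = commSignOn S g k * commSignOn S h k := by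
  simp only [commSignOn, ← Finset.prod_mul_distrib]
  exact Finset.prod_congr rfl fun q _ => by
    rw [hG.label_mul hg hh, Pauli.commSign_mulLabel_left]

theorem transposeSignOn_mul (S : Finset Q) {g h : (QOp Q)ˣ} (hg : g ∈ G) (hh : h ∈ G) :
    transposeSignOn S (g * h) =
      transposeSignOn S g * transposeSignOn S h * commSignOn S g h := by
  simp only [commSignOn, transposeSignOn, ← Finset.prod_mul_distrib]
  exact Finset.prod_congr rfl fun q _ => by
    rw [hG.label_mul hg hh, Pauli.transposeSign_mulLabel]

theorem eq_one_of_label {g : (QOp Q)ˣ} (hg : g ∈ G)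
    (h : ∀ q, pauliLabel (g : QOp Q) q = Pauli.I) : g = 1 := by
  obtain ⟨p, hp⟩ := hG.signedPauli g hg
  have e : pauliLabel (g : QOp Q) = fun _ => Pauli.I := funext h
  rcases hp.eq_or with h1 | h1 <;> rw [e, pauliString_I] at h1
  · exact Units.ext h1
  · exact absurd hg (by
      rw [show g = -1 from Units.ext h1]
      exact hG.neg_one_notMem)

theorem trace_eq_zero {g : (QOp Q)ˣ} (hg : g ∈ G) (h : g ≠ 1) : (g : QOp Q).trace = 0 := by
  obtain ⟨p, hp⟩ := hG.signedPauli g hg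
  have : ∃ q, pauliLabel (g : QOp Q) q ≠ Pauli.I := by
    by_contra! hq
    exact h (hG.eq_one_of_label hg hq)
  obtain ⟨q, hq⟩ := this
  rcases hp.eq_or with h1 | h1 <;> rw [h1]
  · exact trace_pauliString_eq_zero hq
  · rw [Matrix.trace_neg, trace_pauliString_eq_zero hq, neg_zero]

/-- An element is determined by its labels: if `g` and `h` have the same ones, `g * h` has only
identity labels, hence is `1` as `-1` is excluded. -/
theorem finite : Finite G := by
  refine Finite.of_injective (fun g : G => pauliLabel ((g : (QOp Q)ˣ) : QOp Q)) ?_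
  rintro ⟨g, hg⟩ ⟨h, hh⟩ e
  simp only at e
  have h1 : g * h = 1 := by
    refine hG.eq_one_of_label (G.mul_mem hg hh) fun q => ?_
    rw [hG.label_mul hg hh, e]
    cases pauliLabel (h : QOp Q) q <;> rfl
  refine Subtype.ext ?_
  rw [← mul_left_inj h]
  rw [h1, hG.mul_self hh]

end IsStabilizerGroup

/-- The sum of the elements of `R`, weighted with the signs `t`. -/
noncomputable def signedSum (R : Subgroup (QOp Q)ˣ) [Fintype R] (t : (QOp Q)ˣ → ℤˣ) : QOp Q :=
  ∑ k : R, ((t k : ℤ) : ℂ) • ((k : (QOp Q)ˣ) : QOp Q)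

/-- In the double sum put `k = g * h`. As `ε g g = 1`, the coefficient `t g * t h` equals `ε g k * t
k`, and orthogonality of the characters `ε · k` leaves only the `k` in the radical `R`. -/
theorem signedSum_mul_signedSum (L R : Subgroup (QOp Q)ˣ) [Fintype L] [Fintype R] (hRL : R ≤ L)
    (t : (QOp Q)ˣ → ℤˣ) (ε : (QOp Q)ˣ → (QOp Q)ˣ → ℤˣ)
    (ht : ∀ g ∈ L, ∀ h ∈ L, t (g * h) = t g * t h * ε g h)
    (hεl : ∀ g ∈ L, ∀ h ∈ L, ∀ k ∈ L, ε (g * h) k = ε g k * ε h k)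
    (hεr : ∀ g ∈ L, ∀ h ∈ L, ∀ k ∈ L, ε k (g * h) = ε k g * ε k h)
    (hεs : ∀ g ∈ L, ε g g = 1)
    (hR : ∀ k ∈ L, k ∈ R ↔ ∀ g ∈ L, ε g k = 1) :
    signedSum L t * signedSum L t = (Fintype.card L : ℂ) • signedSum R t := by
  classical
  have hsum : ∀ k ∈ L, ∑ g : L, ((ε g k : ℤ) : ℂ) = if k ∈ R then (Fintype.card L : ℂ) else 0 := by
    intro k hk
    split_ifs with hkR
    · rw [Finset.sum_congr rfl fun g _ => by rw [(hR k hk).1 hkR g g.2]]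
      simp
    · rw [hR k hk] at hkR
      push Not at hkR
      obtain ⟨g₀, hg₀, h1⟩ := hkR
      have h2 : ε g₀ k = -1 := (Int.units_eq_one_or _).resolve_left h1
      -- Translation by `g₀` permutes the terms, yet negates the sum, so the sum is zero.
      have h3 : ∑ g : L, ((ε g k : ℤ) : ℂ) = ∑ g : L, ((ε (g₀ * g) k : ℤ) : ℂ) :=
        (Fintype.sum_equiv (Equiv.mulLeft (⟨g₀, hg₀⟩ : L)) _ _ fun g => rfl).symm
      have h4 : ∑ g : L, ((ε (g₀ * g) k : ℤ) : ℂ) = -∑ g : L, ((ε g k : ℤ) : ℂ) := by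
        rw [← Finset.sum_neg_distrib]
        exact Finset.sum_congr rfl fun g _ => by rw [hεl _ hg₀ _ g.2 _ hk, h2]; simp
      rw [h4] at h3
      exact self_eq_neg.1 h3
  have hterm : ∀ g k : L, ε (g : (QOp Q)ˣ) ((g : (QOp Q)ˣ)⁻¹ * k) = ε g k := by
    intro g k
    have e1 : ε (g : (QOp Q)ˣ) 1 = 1 := by
      have := hεr 1 L.one_mem 1 L.one_mem g g.2
      rw [mul_one] at this
      exact (mul_eq_left.1 this.symm)
    have e2 : ε (g : (QOp Q)ˣ) (g : (QOp Q)ˣ)⁻¹ = 1 := by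
      have := hεr g g.2 _ (L.inv_mem g.2) g g.2
      rwa [mul_inv_cancel, e1, hεs g g.2, one_mul, eq_comm] at this
    rw [hεr _ (L.inv_mem g.2) _ k.2 _ g.2, e2, one_mul]
  calc signedSum L t * signedSum L t
      = ∑ g : L, ∑ h : L, ((t g : ℤ) : ℂ) • ((t h : ℤ) : ℂ) •
          (((g * h : L) : (QOp Q)ˣ) : QOp Q) := by
        rw [signedSum, Finset.sum_mul_sum]
        refine Finset.sum_congr rfl fun g _ => Finset.sum_congr rfl fun h _ => ?_
        rw [Matrix.smul_mul, Matrix.mul_smul]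
        rfl
    _ = ∑ g : L, ∑ k : L, ((ε g k : ℤ) : ℂ) • ((t k : ℤ) : ℂ) • ((k : (QOp Q)ˣ) : QOp Q) := by
        refine Finset.sum_congr rfl fun g _ => ?_
        refine Fintype.sum_equiv (Equiv.mulLeft g) _ _ fun h => ?_
        have e1 := hterm g (g * h)
        rw [Subgroup.coe_mul, inv_mul_cancel_left] at e1
        simp only [Equiv.coe_mulLeft]
        rw [smul_smul, smul_smul]
        congr 1
        rw [Subgroup.coe_mul, ← e1, ht g g.2 h h.2]
        have : (ε (g : (QOp Q)ˣ) h) * (ε (g : (QOp Q)ˣ) h) = 1 := Int.units_mul_self _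
        have h' : ((ε (g : (QOp Q)ˣ) h : ℤ) : ℂ) * ((ε (g : (QOp Q)ˣ) h : ℤ) : ℂ) = 1 := by
          rw [← Int.cast_mul, ← Units.val_mul, this]; simp
        push_cast
        linear_combination (-(((t g : ℤ) : ℂ) * ((t h : ℤ) : ℂ))) * h'
    _ = ∑ k : L, if (k : (QOp Q)ˣ) ∈ R then
          (Fintype.card L : ℂ) • ((t k : ℤ) : ℂ) • ((k : (QOp Q)ˣ) : QOp Q) else 0 := by
        rw [Finset.sum_comm]
        refine Finset.sum_congr rfl fun k _ => ?_
        rw [← Finset.sum_smul, hsum k k.2]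
        split_ifs <;> simp
    _ = (Fintype.card L : ℂ) • signedSum R t := by
        rw [signedSum, Finset.smul_sum, ← Finset.sum_filter]
        symm
        refine Finset.sum_bij (fun k _ => ⟨(k : (QOp Q)ˣ), hRL k.2⟩) ?_ ?_ ?_ ?_
        · intro k _; simp
        · intro a _ b _ h; exact Subtype.ext (congrArg (fun x : L => (x : (QOp Q)ˣ)) h)
        · intro b hb
          exact ⟨⟨b, (Finset.mem_filter.1 hb).2⟩, Finset.mem_univ _, rfl⟩
        · intro k _; rfl

theorem IsStabilizerGroup.signedSum_conjTranspose {R : Subgroup (QOp Q)ˣ} [Fintype R]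
    (hR : IsStabilizerGroup R) (t : (QOp Q)ˣ → ℤˣ) :
    (signedSum R t).conjTranspose = signedSum R t := by
  simp only [signedSum, Matrix.conjTranspose_sum, Matrix.conjTranspose_smul]
  refine Finset.sum_congr rfl fun k _ => ?_
  obtain ⟨p, hp⟩ := hR.signedPauli k k.2
  rw [hp.conjTranspose]
  simp

theorem IsStabilizerGroup.trace_signedSum {R : Subgroup (QOp Q)ˣ} [Fintype R]
    (hR : IsStabilizerGroup R) {t : (QOp Q)ˣ → ℤˣ} (ht : t 1 = 1) :
    (signedSum R t).trace = 2 ^ Fintype.card Q := by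
  simp only [signedSum, Matrix.trace_sum, Matrix.trace_smul]
  rw [Finset.sum_eq_single (1 : R)]
  · simp [ht]
  · intro k _ hk
    rw [hR.trace_eq_zero k.2 (fun h => hk (Subtype.ext h)), smul_zero]
  · simp

/-- A sign-twisted average over a stabilizer group is an orthogonal projection. -/
theorem IsStabilizerGroup.signedSum_projection {R : Subgroup (QOp Q)ˣ} [Fintype R]
    (hR : IsStabilizerGroup R) {t : (QOp Q)ˣ → ℤˣ}
    (ht : ∀ g ∈ R, ∀ h ∈ R, t (g * h) = t g * t h) :
    ∃ P : QOp Q, P * P = P ∧ P.IsHermitian ∧ signedSum R t = (Fintype.card R : ℝ) • P ∧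
      P.trace = (((2 : ℝ) ^ Fintype.card Q / Fintype.card R : ℝ) : ℂ) := by
  have hc : (Fintype.card R : ℝ) ≠ 0 := by exact_mod_cast Fintype.card_ne_zero
  have hc' : (Fintype.card R : ℂ) ≠ 0 := by exact_mod_cast Fintype.card_ne_zero
  have ht1 : t 1 = 1 := by
    have := ht 1 R.one_mem 1 R.one_mem
    rw [mul_one] at this
    exact (mul_eq_left.1 this.symm)
  refine ⟨((Fintype.card R : ℝ)⁻¹) • signedSum R t, ?_, ?_, ?_, ?_⟩
  -- A character `t` has no commutation defect, so the square formula applies with `ε = 1`, whose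
  -- radical is all of `R`.
  · have hsq := signedSum_mul_signedSum R R le_rfl t (fun _ _ => 1)
      (fun g hg h hh => by rw [ht g hg h hh, mul_one]) (by simp) (by simp) (by simp)
      (fun k hk => by simp [hk])
    rw [Matrix.smul_mul, Matrix.mul_smul, hsq]
    ext i j
    simp
  · rw [Matrix.IsHermitian, Matrix.conjTranspose_smul, hR.signedSum_conjTranspose]
    simp
  · rw [smul_smul, mul_inv_cancel₀ hc, one_smul]
  · rw [Matrix.trace_smul, hR.trace_signedSum ht1, Complex.real_smul]
    push_cast
    ring

end Signs

/-! ### Elementary abelian 2-groups and alternating sign forms. -/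

section ElementaryAbelian
variable {U : Type*} [Group U]

/-- The ambient group is not commutative, so the join of two commuting subgroups is treated as the
range of `MonoidHom.noncommCoprod`. -/
theorem Subgroup.exists_mul_of_mem_sup {H K : Subgroup U} (h : ∀ a ∈ H, ∀ b ∈ K, Commute a b)
    {x : U} (hx : x ∈ H ⊔ K) : ∃ a ∈ H, ∃ b ∈ K, a * b = x := by
  have e := MonoidHom.noncommCoprod_range H.subtype K.subtype fun a b => h a a.2 b b.2
  rw [Subgroup.range_subtype, Subgroup.range_subtype] at e
  rw [← e] at hx
  obtain ⟨⟨a, b⟩, rfl⟩ := hx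
  exact ⟨a, a.2, b, b.2, rfl⟩

theorem Subgroup.card_sup_of_disjoint {H K : Subgroup U} (h : ∀ a ∈ H, ∀ b ∈ K, Commute a b)
    (hd : Disjoint H K) : Nat.card ↥(H ⊔ K) = Nat.card H * Nat.card K := by
  have e := MonoidHom.noncommCoprod_range H.subtype K.subtype fun a b => h a a.2 b b.2
  have hi := (MonoidHom.noncommCoprod_injective H.subtype K.subtype fun a b => h a a.2 b b.2).2
    ⟨H.subtype_injective, K.subtype_injective, by simpa using hd⟩
  rw [Subgroup.range_subtype, Subgroup.range_subtype] at e
  rw [← e, ← Nat.card_prod]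
  exact (Nat.card_congr (MonoidHom.ofInjective hi).toEquiv).symm

theorem Subgroup.card_sup_le {H K : Subgroup U} [Finite H] [Finite K]
    (h : ∀ a ∈ H, ∀ b ∈ K, Commute a b) : Nat.card ↥(H ⊔ K) ≤ Nat.card H * Nat.card K := by
  have e := MonoidHom.noncommCoprod_range H.subtype K.subtype fun a b => h a a.2 b b.2
  rw [Subgroup.range_subtype, Subgroup.range_subtype] at e
  rw [← e, ← Nat.card_prod]
  exact Nat.card_le_card_of_surjective _ (MonoidHom.rangeRestrict_surjective _)

theorem commute_of_mul_self_eq_one {L : Subgroup U} (hL : ∀ g ∈ L, g * g = 1) {a b : U}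
    (ha : a ∈ L) (hb : b ∈ L) : Commute a b := by
  have hi : ∀ g ∈ L, g⁻¹ = g := fun g hg => inv_eq_of_mul_eq_one_left (hL g hg)
  have := hi _ (L.mul_mem ha hb)
  rw [mul_inv_rev, hi a ha, hi b hb] at this
  exact this.symm

theorem eq_one_or_eq_of_mem_zpowers {x g : U} (hx : x * x = 1) (hg : g ∈ Subgroup.zpowers x) :
    g = 1 ∨ g = x := by
  obtain ⟨n, rfl⟩ := hg
  rcases Int.even_or_odd' n with ⟨k, rfl | rfl⟩
  · left
    simp [zpow_mul, pow_two, zpow_ofNat, hx]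
  · right
    simp [zpow_add, zpow_mul, pow_two, zpow_ofNat, hx]

theorem card_zpowers_of_involution {x : U} (hx : x * x = 1) (h1 : x ≠ 1) :
    Nat.card (Subgroup.zpowers x) = 2 := by
  rw [Nat.card_zpowers]
  exact orderOf_eq_prime (by rw [pow_two, hx]) h1

/-- Subgroups of a finite elementary abelian 2-group have complements. -/
theorem exists_disjoint_sup_eq {L : Subgroup U} [Finite L] (hL : ∀ g ∈ L, g * g = 1)
    {K : Subgroup U} (hK : K ≤ L) : ∃ H ≤ L, Disjoint K H ∧ K ⊔ H = L := by
  -- `H` is enlarged by an element outside `K ⊔ H` for as long as there is one; `n` bounds the room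
  -- left in `L`.
  have key : ∀ n : ℕ, ∀ H ≤ L, Disjoint K H → Nat.card L < Nat.card H + n →
      ∃ H ≤ L, Disjoint K H ∧ K ⊔ H = L := by
    intro n
    induction n with
    | zero =>
      intro H hH _ hlt
      exact absurd (Subgroup.card_le_of_le hH) (by omega)
    | succ n ih =>
      intro H hH hd hlt
      by_cases hKH : K ⊔ H = L
      · exact ⟨H, hH, hd, hKH⟩
      obtain ⟨x, hxL, hx⟩ := SetLike.exists_of_lt (lt_of_le_of_ne (sup_le hK hH) hKH)
      have hzL : Subgroup.zpowers x ≤ L := by simpa using hxL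
      have hcomm : ∀ a ∈ H, ∀ b ∈ Subgroup.zpowers x, Commute a b := fun a ha b hb =>
        commute_of_mul_self_eq_one hL (hH ha) (hzL hb)
      refine ih (H ⊔ Subgroup.zpowers x) (sup_le hH hzL) ?_ ?_
      · rw [Subgroup.disjoint_def]
        intro k hk hk'
        obtain ⟨a, ha, b, hb, rfl⟩ := Subgroup.exists_mul_of_mem_sup hcomm hk'
        rcases eq_one_or_eq_of_mem_zpowers (hL x hxL) hb with rfl | rfl
        · rw [mul_one] at hk ⊢
          exact Subgroup.disjoint_def.1 hd hk ha
        · refine absurd ?_ hx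
          have := (K ⊔ H).mul_mem (Subgroup.mem_sup_right (H.inv_mem ha))
            (Subgroup.mem_sup_left hk)
          rwa [inv_mul_cancel_left] at this
      · have hdx : Disjoint H (Subgroup.zpowers x) := by
          rw [Subgroup.disjoint_def]
          intro a ha ha'
          rcases eq_one_or_eq_of_mem_zpowers (hL x hxL) ha' with rfl | rfl
          · rfl
          · exact absurd (Subgroup.mem_sup_right ha) hx
        have hx1 : x ≠ 1 := fun h => hx (h ▸ (K ⊔ H).one_mem)
        rw [Subgroup.card_sup_of_disjoint hcomm hdx,
          card_zpowers_of_involution (hL x hxL) hx1]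
        have : Finite H := Finite.of_injective _ (Subgroup.inclusion_injective hH)
        have : 0 < Nat.card H := Nat.card_pos
        omega
  exact key (Nat.card L + 1) ⊥ bot_le disjoint_bot_right (by omega)

/-- Split off one involution; its complement has half the order, and induction applies to it. -/
theorem exists_generators_card_eq_two_pow (n : ℕ) : ∀ (L : Subgroup U) [Finite L],
    (∀ g ∈ L, g * g = 1) → Nat.card L ≤ n →
    ∃ (r : ℕ) (z : Fin r → U), Subgroup.closure (Set.range z) = L ∧ Nat.card L = 2 ^ r := by
  induction n with
  | zero =>
    intro L _ _ h
    exact absurd (Nat.card_pos (α := L)) (by omega)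
  | succ n ih =>
    intro L _ hL hn
    by_cases hb : L = ⊥
    · subst hb
      exact ⟨0, Fin.elim0, by simp, by simp⟩
    obtain ⟨x, hx, hx1⟩ := L.bot_or_exists_ne_one.resolve_left hb
    have hzL : Subgroup.zpowers x ≤ L := by simpa using hx
    obtain ⟨H, hHL, hd, hsup⟩ := exists_disjoint_sup_eq hL hzL
    have hcard := Subgroup.card_sup_of_disjoint (fun a ha b hb =>
      commute_of_mul_self_eq_one hL (hzL ha) (hHL hb)) hd
    rw [hsup, card_zpowers_of_involution (hL x hx) hx1] at hcard
    have : Finite H := Finite.of_injective _ (Subgroup.inclusion_injective hHL)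
    have hpos : 0 < Nat.card H := Nat.card_pos
    obtain ⟨r, z, hz, hr⟩ := ih H (fun g hg => hL g (hHL hg)) (by omega)
    refine ⟨r + 1, Fin.cons x z, ?_, by rw [hcard, hr, pow_succ, mul_comm]⟩
    rw [Fin.range_cons, Set.insert_eq, Subgroup.closure_union, ← Subgroup.zpowers_eq_closure, hz,
      hsup]

theorem card_closure_le_two_pow {L : Subgroup U} [Finite L] (hL : ∀ g ∈ L, g * g = 1)
    [DecidableEq U] (T : Finset U) (hT : ∀ x ∈ T, x ∈ L) :
    Nat.card (Subgroup.closure (T : Set U)) ≤ 2 ^ T.card := by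
  induction T using Finset.induction_on with
  | empty => simp
  | insert x T hxT ih =>
    have hx : x ∈ L := hT x (Finset.mem_insert_self _ _)
    have hT' : ∀ y ∈ T, y ∈ L := fun y hy => hT y (Finset.mem_insert_of_mem hy)
    have hzL : Subgroup.zpowers x ≤ L := by simpa using hx
    have hcL : Subgroup.closure (T : Set U) ≤ L := (Subgroup.closure_le L).2 hT'
    have : Finite (Subgroup.zpowers x) := Finite.of_injective _ (Subgroup.inclusion_injective hzL)
    have : Finite (Subgroup.closure (T : Set U)) :=
      Finite.of_injective _ (Subgroup.inclusion_injective hcL)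
    rw [Finset.coe_insert, Set.insert_eq, Subgroup.closure_union, ← Subgroup.zpowers_eq_closure,
      Finset.card_insert_of_notMem hxT, pow_succ, mul_comm]
    refine (Subgroup.card_sup_le fun a ha b hb =>
      commute_of_mul_self_eq_one hL (hzL ha) (hcL hb)).trans (Nat.mul_le_mul ?_ (ih hT'))
    rw [Nat.card_zpowers]
    exact orderOf_le_of_pow_eq_one two_pos (by rw [pow_two, hL x hx])

/-- Generators of an elementary abelian 2-group are distinct if their number is the rank. -/
theorem injective_of_card_closure_range {L : Subgroup U} [Finite L] (hL : ∀ g ∈ L, g * g = 1)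
    {ι : Type*} [Fintype ι] (x : ι → U) (hx : Subgroup.closure (Set.range x) = L)
    (hcard : Nat.card L = 2 ^ Fintype.card ι) : Function.Injective x := by
  classical
  -- Each generator at most doubles the order, so a coincidence among the generators would make the
  -- group too small.
  have h := card_closure_le_two_pow hL (Finset.univ.image x) (by
    intro y hy
    obtain ⟨i, -, rfl⟩ := Finset.mem_image.1 hy
    rw [← hx]
    exact Subgroup.subset_closure ⟨i, rfl⟩)
  rw [Finset.coe_image, Finset.coe_univ, Set.image_univ, hx, hcard,
    Nat.pow_le_pow_iff_right (by norm_num)] at h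
  have := Finset.card_image_iff.1 (le_antisymm Finset.card_image_le h : _ = Finset.univ.card)
  exact fun a b hab => this (Finset.mem_coe.2 (Finset.mem_univ _))
    (Finset.mem_coe.2 (Finset.mem_univ _)) hab

/-- Alternating bimultiplicative sign forms on a subgroup. -/
structure IsSignForm (L : Subgroup U) (ε : U → U → ℤˣ) : Prop where
  mul_left : ∀ g ∈ L, ∀ h ∈ L, ∀ k ∈ L, ε (g * h) k = ε g k * ε h k
  symm : ∀ g h, ε g h = ε h g
  self : ∀ g, ε g g = 1

theorem IsSignForm.mono {L H : Subgroup U} {ε : U → U → ℤˣ} (hε : IsSignForm L ε) (h : H ≤ L) :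
    IsSignForm H ε :=
  ⟨fun g hg k hk l hl => hε.mul_left g (h hg) k (h hk) l (h hl), hε.symm, hε.self⟩

theorem IsSignForm.one_left {L : Subgroup U} {ε : U → U → ℤˣ} (hε : IsSignForm L ε) {k : U}
    (hk : k ∈ L) : ε 1 k = 1 := by
  have := hε.mul_left 1 L.one_mem 1 L.one_mem k hk
  rw [mul_one] at this
  exact mul_eq_left.1 this.symm

theorem IsSignForm.mul_right {L : Subgroup U} {ε : U → U → ℤˣ} (hε : IsSignForm L ε) :
    ∀ g ∈ L, ∀ h ∈ L, ∀ k ∈ L, ε k (g * h) = ε k g * ε k h := by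
  intro g hg h hh k hk
  rw [hε.symm k, hε.symm k, hε.symm k, hε.mul_left g hg h hh k hk]

/-- The elements of `L` orthogonal to `x`. -/
def IsSignForm.orthogonal {L : Subgroup U} {ε : U → U → ℤˣ} (hε : IsSignForm L ε)
    {x : U} (hx : x ∈ L) : Subgroup U where
  carrier := {g | g ∈ L ∧ ε g x = 1}
  mul_mem' := fun ha hb =>
    ⟨L.mul_mem ha.1 hb.1, by rw [hε.mul_left _ ha.1 _ hb.1 _ hx, ha.2, hb.2, mul_one]⟩
  one_mem' := ⟨L.one_mem, hε.one_left hx⟩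
  inv_mem' := by
    intro a ha
    refine ⟨L.inv_mem ha.1, ?_⟩
    have := hε.mul_left _ ha.1 _ (L.inv_mem ha.1) _ hx
    rwa [mul_inv_cancel, hε.one_left hx, ha.2, one_mul, eq_comm] at this

theorem IsSignForm.mem_orthogonal {L : Subgroup U} {ε : U → U → ℤˣ} (hε : IsSignForm L ε)
    {x : U} (hx : x ∈ L) {g : U} : g ∈ hε.orthogonal hx ↔ g ∈ L ∧ ε g x = 1 := Iff.rfl

/-- The relations of a symplectic family with a radical part. -/
structure IsSymplecticFamily (ε : U → U → ℤˣ) {r s : ℕ} (z : Fin r → U) (w wbar : Fin s → U) :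
    Prop where
  z_z : ∀ i j, ε (z i) (z j) = 1
  z_w : ∀ i j, ε (z i) (w j) = 1
  z_wbar : ∀ i j, ε (z i) (wbar j) = 1
  w_w : ∀ i j, ε (w i) (w j) = 1
  wbar_wbar : ∀ i j, ε (wbar i) (wbar j) = 1
  w_wbar : ∀ i j, ε (w i) (wbar j) = if i = j then -1 else 1

/-- A sign form on a finite elementary abelian 2-group has a symplectic family of independent
generators. -/
theorem exists_symplectic_generators (ε : U → U → ℤˣ) (n : ℕ) : ∀ (L : Subgroup U) [Finite L],
    (∀ g ∈ L, g * g = 1) → IsSignForm L ε → Nat.card L ≤ n →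
    ∃ (r s : ℕ) (z : Fin r → U) (w wbar : Fin s → U),
      Subgroup.closure (Set.range z ∪ Set.range w ∪ Set.range wbar) = L ∧
      Nat.card L = 2 ^ (r + 2 * s) ∧ IsSymplecticFamily ε z w wbar := by
  induction n with
  | zero =>
    intro L _ _ _ h
    exact absurd (Nat.card_pos (α := L)) (by omega)
  | succ n ih =>
    intro L _ hL hε hn
    by_cases htriv : ∀ g ∈ L, ∀ h ∈ L, ε g h = 1
    · obtain ⟨r, z, hz, hr⟩ := exists_generators_card_eq_two_pow _ L hL le_rfl
      have hzL : ∀ i, z i ∈ L := fun i => hz ▸ Subgroup.subset_closure ⟨i, rfl⟩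
      refine ⟨r, 0, z, Fin.elim0, Fin.elim0, by simpa using hz, by simpa using hr, ?_⟩
      exact ⟨fun i j => htriv _ (hzL i) _ (hzL j), fun _ j => j.elim0, fun _ j => j.elim0,
        fun i => i.elim0, fun i => i.elim0, fun i => i.elim0⟩
    push Not at htriv
    obtain ⟨a, ha, b, hb, hab⟩ := htriv
    replace hab : ε a b = -1 := (Int.units_eq_one_or _).resolve_left hab
    have hba : ε b a = -1 := by rw [hε.symm, hab]
    have hne : (-1 : ℤˣ) ≠ 1 := by decide
    -- Symplectic Gram–Schmidt: the hyperbolic pair `a`, `b` splits off, and the induction continues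
    -- in its orthogonal complement `H`.
    set H := hε.orthogonal ha ⊓ hε.orthogonal hb with hH
    have hHmem : ∀ g, g ∈ H ↔ g ∈ L ∧ ε g a = 1 ∧ ε g b = 1 := by
      intro g
      rw [hH, Subgroup.mem_inf, hε.mem_orthogonal, hε.mem_orthogonal]
      tauto
    have hHL : H ≤ L := fun g hg => ((hHmem g).1 hg).1
    have hzaL : Subgroup.zpowers a ≤ L := by simpa using ha
    have hzbL : Subgroup.zpowers b ≤ L := by simpa using hb
    set K := Subgroup.zpowers a ⊔ Subgroup.zpowers b with hK
    have hKL : K ≤ L := sup_le hzaL hzbL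
    have haK : a ∈ K := Subgroup.mem_sup_left (Subgroup.mem_zpowers a)
    have hbK : b ∈ K := Subgroup.mem_sup_right (Subgroup.mem_zpowers b)
    have hcomm : ∀ {x y : U}, x ∈ L → y ∈ L → Commute x y := fun hx hy =>
      commute_of_mul_self_eq_one hL hx hy
    have ha1 : a ≠ 1 := by
      rintro rfl
      exact hne (hab.symm.trans (hε.one_left hb))
    have hb1 : b ≠ 1 := by
      rintro rfl
      exact hne (hba.symm.trans (hε.one_left ha))
    have hdab : Disjoint (Subgroup.zpowers a) (Subgroup.zpowers b) := by
      rw [Subgroup.disjoint_def]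
      intro x hx hx'
      rcases eq_one_or_eq_of_mem_zpowers (hL a ha) hx with rfl | rfl
      · rfl
      rcases eq_one_or_eq_of_mem_zpowers (hL b hb) hx' with h | rfl
      · exact h
      · exact absurd (hab.symm.trans (hε.self _)) hne
    have hcardK : Nat.card K = 4 := by
      rw [hK, Subgroup.card_sup_of_disjoint (fun x hx y hy => hcomm (hzaL hx) (hzbL hy)) hdab,
        card_zpowers_of_involution (hL a ha) ha1, card_zpowers_of_involution (hL b hb) hb1]
    have hdKH : Disjoint K H := by
      rw [Subgroup.disjoint_def]
      intro x hx hx'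
      obtain ⟨u, hu, v, hv, rfl⟩ := Subgroup.exists_mul_of_mem_sup
        (fun x hx y hy => hcomm (hzaL hx) (hzbL hy)) hx
      obtain ⟨-, h1, h2⟩ := (hHmem _).1 hx'
      rw [hε.mul_left _ (hzaL hu) _ (hzbL hv) _ ha] at h1
      rw [hε.mul_left _ (hzaL hu) _ (hzbL hv) _ hb] at h2
      rcases eq_one_or_eq_of_mem_zpowers (hL a ha) hu with rfl | rfl <;>
        rcases eq_one_or_eq_of_mem_zpowers (hL b hb) hv with rfl | rfl
      · simp
      · rw [hε.one_left ha, hba, one_mul] at h1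
        exact absurd h1 hne
      · rw [hε.one_left hb, hab, mul_one] at h2
        exact absurd h2 hne
      · rw [hε.self, hab, mul_one] at h2
        exact absurd h2 hne
    -- Multiplying `g` by `a` corrects its pairing with `b`, and multiplying by `b` its pairing with
    -- `a`; the four sign patterns call for `1`, `a`, `b`, `a * b`.
    have hsup : K ⊔ H = L := by
      refine le_antisymm (sup_le hKL hHL) fun g hg => ?_
      have key : ∀ k ∈ K, g * k ∈ H → g ∈ K ⊔ H := fun k hk h => by
        have := (K ⊔ H).mul_mem (Subgroup.mem_sup_right h) (Subgroup.mem_sup_left (K.inv_mem hk))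
        rwa [mul_inv_cancel_right] at this
      have hmul : ∀ k ∈ K, (g * k ∈ H ↔ ε g a * ε k a = 1 ∧ ε g b * ε k b = 1) := fun k hk => by
        rw [hHmem, hε.mul_left _ hg _ (hKL hk) _ ha, hε.mul_left _ hg _ (hKL hk) _ hb]
        exact and_iff_right (L.mul_mem hg (hKL hk))
      rcases Int.units_eq_one_or (ε g a) with h1 | h1 <;>
        rcases Int.units_eq_one_or (ε g b) with h2 | h2
      · refine key 1 K.one_mem ((hmul 1 K.one_mem).2 ?_)
        rw [h1, h2, hε.one_left ha, hε.one_left hb]; simp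
      · refine key a haK ((hmul a haK).2 ?_)
        rw [h1, h2, hε.self, hab]; simp
      · refine key b hbK ((hmul b hbK).2 ?_)
        rw [h1, h2, hε.self, hba]; simp
      · refine key (a * b) (K.mul_mem haK hbK) ((hmul _ (K.mul_mem haK hbK)).2 ?_)
        rw [h1, h2, hε.mul_left _ ha _ hb _ ha, hε.mul_left _ ha _ hb _ hb, hε.self, hε.self,
          hab, hba]
        simp
    have hcard := Subgroup.card_sup_of_disjoint
      (fun x hx y hy => hcomm (hKL hx) (hHL hy)) hdKH
    rw [hsup, hcardK] at hcard
    have : Finite H := Finite.of_injective _ (Subgroup.inclusion_injective hHL)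
    have hpos : 0 < Nat.card H := Nat.card_pos
    obtain ⟨r, s, z, w, wbar, hgen, hr, hf⟩ :=
      ih H (fun g hg => hL g (hHL hg)) (hε.mono hHL) (by omega)
    have hzH : ∀ i, z i ∈ H := fun i =>
      hgen ▸ Subgroup.subset_closure (Or.inl (Or.inl ⟨i, rfl⟩))
    have hwH : ∀ i, w i ∈ H := fun i =>
      hgen ▸ Subgroup.subset_closure (Or.inl (Or.inr ⟨i, rfl⟩))
    have hwbH : ∀ i, wbar i ∈ H := fun i =>
      hgen ▸ Subgroup.subset_closure (Or.inr ⟨i, rfl⟩)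
    have hHa : ∀ g ∈ H, ε g a = 1 := fun g hg => ((hHmem g).1 hg).2.1
    have hHb : ∀ g ∈ H, ε g b = 1 := fun g hg => ((hHmem g).1 hg).2.2
    have haH : ∀ g ∈ H, ε a g = 1 := fun g hg => by rw [hε.symm, hHa g hg]
    have hbH : ∀ g ∈ H, ε b g = 1 := fun g hg => by rw [hε.symm, hHb g hg]
    refine ⟨r, s + 1, z, Fin.cons a w, Fin.cons b wbar, ?_, ?_, ?_⟩
    · rw [Fin.range_cons, Fin.range_cons, Set.insert_eq, Set.insert_eq]
      simp only [Subgroup.closure_union] at hgen ⊢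
      rw [← Subgroup.zpowers_eq_closure, ← Subgroup.zpowers_eq_closure, ← hsup, ← hgen, hK]
      ac_rfl
    · rw [hcard, hr]
      ring
    · refine ⟨hf.z_z, fun i j => ?_, fun i j => ?_, fun i j => ?_, fun i j => ?_, fun i j => ?_⟩
      · refine Fin.cases ?_ (fun j => ?_) j
        · exact hHa _ (hzH i)
        · exact hf.z_w i j
      · refine Fin.cases ?_ (fun j => ?_) j
        · exact hHb _ (hzH i)
        · exact hf.z_wbar i j
      · refine Fin.cases ?_ (fun i => ?_) i <;> refine Fin.cases ?_ (fun j => ?_) j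
        · exact hε.self a
        · exact haH _ (hwH j)
        · exact hHa _ (hwH i)
        · exact hf.w_w i j
      · refine Fin.cases ?_ (fun i => ?_) i <;> refine Fin.cases ?_ (fun j => ?_) j
        · exact hε.self b
        · exact hbH _ (hwbH j)
        · exact hHb _ (hwbH i)
        · exact hf.wbar_wbar i j
      · refine Fin.cases ?_ (fun i => ?_) i <;> refine Fin.cases ?_ (fun j => ?_) j
        · simpa using hab
        · simpa [(Fin.succ_ne_zero j).symm] using haH _ (hwbH j)
        · simpa [Fin.succ_ne_zero i] using hHb _ (hwH i)
        · simpa using hf.w_wbar i j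

/-- The radical of a sign form with a symplectic family of `s` pairs has index `2 ^ (2 s)`. -/
theorem exists_radical {L K : Subgroup U} {ε : U → U → ℤˣ} (hε : IsSignForm L ε)
    {r s : ℕ} {z : Fin r → U} {w wbar : Fin s → U} (hf : IsSymplecticFamily ε z w wbar)
    (hK : ∀ g ∈ K, ∀ h ∈ L, ε g h = 1)
    (hgen : K ⊔ Subgroup.closure (Set.range z ∪ Set.range w ∪ Set.range wbar) = L) :
    ∃ R ≤ L, (∀ k ∈ L, k ∈ R ↔ ∀ g ∈ L, ε g k = 1) ∧
      Nat.card R * 2 ^ (2 * s) = Nat.card L := by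
  have hcL : Set.range z ∪ Set.range w ∪ Set.range wbar ⊆ L := fun g hg =>
    hgen.le (Subgroup.mem_sup_right (Subgroup.subset_closure hg))
  have hzL : ∀ i, z i ∈ L := fun i => hcL (Or.inl (Or.inl ⟨i, rfl⟩))
  have hwL : ∀ i, w i ∈ L := fun i => hcL (Or.inl (Or.inr ⟨i, rfl⟩))
  have hwbL : ∀ i, wbar i ∈ L := fun i => hcL (Or.inr ⟨i, rfl⟩)
  -- Orthogonality to `k` need only be tested on generators, since the elements orthogonal to `k`
  -- form a subgroup; those of `K` are orthogonal by hypothesis.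
  have hrad : ∀ k ∈ L, (∀ i, ε (z i) k = 1) → (∀ j, ε (w j) k = 1) → (∀ j, ε (wbar j) k = 1) →
      ∀ g ∈ L, ε g k = 1 := by
    intro k hk h1 h2 h3 g hg
    have hle : L ≤ hε.orthogonal hk := by
      refine hgen.symm.le.trans ?_
      refine sup_le (fun x hx => ⟨hgen.le (Subgroup.mem_sup_left hx), hK x hx k hk⟩)
        ((Subgroup.closure_le _).2 ?_)
      rintro x ((⟨i, rfl⟩ | ⟨i, rfl⟩) | ⟨i, rfl⟩)
      · exact ⟨hzL i, h1 i⟩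
      · exact ⟨hwL i, h2 i⟩
      · exact ⟨hwbL i, h3 i⟩
    exact (hle hg).2
  have hz : ∀ i, ∀ g ∈ L, ε g (z i) = 1 := fun i => hrad _ (hzL i) (fun j => hf.z_z j i)
    (fun j => by rw [hε.symm, hf.z_w]) (fun j => by rw [hε.symm, hf.z_wbar])
  let v : Fin s ⊕ Fin s → U := Sum.elim w wbar
  have hv : ∀ i, v i ∈ L := by rintro (i | i); exacts [hwL i, hwbL i]
  -- The radical is the kernel of `Φ`, the map recording the pairings with all `w j` and `wbar j`.
  -- Each `wbar i` flips exactly the coordinate of `w i` and vice versa, so `Φ` is onto and its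
  -- kernel has index `2 ^ (2 * s)`.
  let Φ : L →* (Fin s ⊕ Fin s → ℤˣ) := MonoidHom.mk' (fun k i => ε (v i) k) fun a b => by
    funext i
    exact hε.mul_right _ a.2 _ b.2 _ (hv i)
  have hsurj : Function.Surjective Φ := by
    rw [← MonoidHom.range_eq_top, eq_top_iff]
    rintro f -
    rw [← Finset.univ_prod_mulSingle f]
    refine Subgroup.prod_mem _ fun i _ => ?_
    rcases Int.units_eq_one_or (f i) with h | h
    · rw [h, Pi.mulSingle_one]
      exact one_mem _
    rw [h]
    rcases i with i | i
    · refine ⟨⟨wbar i, hwbL i⟩, ?_⟩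
      funext j
      rcases j with j | j
      · change ε (w j) (wbar i) = _
        rw [hf.w_wbar]
        simp [Pi.mulSingle_apply]
      · change ε (wbar j) (wbar i) = _
        rw [hf.wbar_wbar]
        simp
    · refine ⟨⟨w i, hwL i⟩, ?_⟩
      funext j
      rcases j with j | j
      · change ε (w j) (w i) = _
        rw [hf.w_w]
        simp
      · change ε (wbar j) (w i) = _
        rw [hε.symm, hf.w_wbar]
        simp [Pi.mulSingle_apply, eq_comm]
  refine ⟨Φ.ker.map L.subtype, Subgroup.map_subtype_le _, fun k hk => ?_, ?_⟩
  · constructor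
    · rintro ⟨⟨k', hk'⟩, hker, rfl⟩
      have h : ∀ i, ε (v i) k' = 1 := fun i => congrFun (MonoidHom.mem_ker.1 hker) i
      exact hrad _ hk' (fun i => (hε.symm _ _).trans (hz i _ hk')) (fun j => h (Sum.inl j))
        (fun j => h (Sum.inr j))
    · intro h
      exact ⟨⟨k, hk⟩, MonoidHom.mem_ker.2 (funext fun i => h _ (hv i)), rfl⟩
  · have e1 : Nat.card (Φ.ker.map L.subtype) = Nat.card Φ.ker :=
      Nat.card_congr (Φ.ker.equivMapOfInjective _ L.subtype_injective).symm.toEquiv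
    have e2 : Φ.ker.index = 2 ^ (2 * s) := by
      rw [Subgroup.index_ker, MonoidHom.range_eq_top.2 hsurj, Subgroup.card_top,
        Nat.card_eq_fintype_card, Fintype.card_fun, Fintype.card_sum, Fintype.card_fin,
        Fintype.card_units_int, two_mul]
    rw [e1, ← e2, Subgroup.card_mul_index]

end ElementaryAbelian

/-! ### Embedding, partial trace and partial transpose of Pauli strings. -/

section LocalOperators
variable {Q : Type*} [Fintype Q] [DecidableEq Q]

/-- Pauli labels on `S`, extended by the identity. -/
noncomputable def extendLabel (S : Finset Q) (p : {q // q ∈ S} → Pauli) (q : Q) : Pauli :=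
  if h : q ∈ S then p ⟨q, h⟩ else Pauli.I

theorem pauliString_apply_split (S : Finset Q) (p : Q → Pauli) (x y : QBasis Q) :
    pauliString p x y = pauliString (fun q : {q // q ∈ S} => p q) (fun q => x q) (fun q => y q) *
      pauliString (fun q : {q // q ∉ S} => p q) (fun q => x q) (fun q => y q) := by
  simp only [pauliString, Matrix.of_apply]
  rw [← Fintype.prod_subtype_mul_prod_subtype (fun q => q ∈ S)
    fun q => (p q).mat (x q) (y q)]
  congr!

theorem embedOp_apply (S : Finset Q) (M : QOp {q // q ∈ S}) (x y : QBasis Q) :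
    embedOp S M x y = M (fun q => x q) (fun q => y q) *
      (1 : QOp {q // q ∉ S}) (fun q => x q) (fun q => y q) := rfl

theorem embedOp_pauliString (S : Finset Q) (p : {q // q ∈ S} → Pauli) :
    embedOp S (pauliString p) = pauliString (extendLabel S p) := by
  ext x y
  rw [embedOp_apply, pauliString_apply_split S, ← pauliString_I]
  congr 3
  · funext q
    simp [extendLabel]
  · funext q
    simp [extendLabel, q.2]

theorem embedOp_neg (S : Finset Q) (M : QOp {q // q ∈ S}) : embedOp S (-M) = -embedOp S M := by
  ext x y
  simp [embedOp_apply]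

theorem partialTrace_smul (S : Finset Q) (c : ℂ) (M : QOp Q) :
    partialTrace S (c • M) = c • partialTrace S M := by
  ext x y
  simp [partialTrace, Finset.mul_sum]

theorem partialTrace_sum (S : Finset Q) {ι : Type*} (s : Finset ι) (M : ι → QOp Q) :
    partialTrace S (∑ i ∈ s, M i) = ∑ i ∈ s, partialTrace S (M i) := by
  ext x y
  simp only [partialTrace, Matrix.of_apply, Matrix.sum_apply]
  exact Finset.sum_comm

omit [Fintype Q] in
theorem splitBasis_symm_mem (S : Finset Q) (x : QBasis {q // q ∈ S}) (z : QBasis {q // q ∉ S}) :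
    (fun q : {q // q ∈ S} => (splitBasis S).symm (x, z) q) = x :=
  congrArg Prod.fst ((splitBasis S).apply_symm_apply (x, z))

omit [Fintype Q] in
theorem splitBasis_symm_notMem (S : Finset Q) (x : QBasis {q // q ∈ S})
    (z : QBasis {q // q ∉ S}) :
    (fun q : {q // q ∉ S} => (splitBasis S).symm (x, z) q) = z :=
  congrArg Prod.snd ((splitBasis S).apply_symm_apply (x, z))

theorem partialTrace_embedOp (S : Finset Q) (M : QOp {q // q ∈ S}) :
    partialTrace S (embedOp S M) = (2 : ℂ) ^ Fintype.card {q // q ∉ S} • M := by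
  ext x y
  have e : ∀ z : QBasis {q // q ∉ S},
      embedOp S M ((splitBasis S).symm (x, z)) ((splitBasis S).symm (y, z)) = M x y := by
    intro z
    rw [embedOp_apply, splitBasis_symm_mem, splitBasis_symm_mem, splitBasis_symm_notMem,
      splitBasis_symm_notMem, Matrix.one_apply_eq, mul_one]
  simp only [partialTrace, Matrix.of_apply, e, Finset.sum_const, Matrix.smul_apply,
    nsmul_eq_mul, smul_eq_mul, Finset.card_univ]
  simp

theorem partialTrace_pauliString (S : Finset Q) (p : Q → Pauli) :
    partialTrace S (pauliString p) =
      (pauliString fun q : {q // q ∉ S} => p q).trace • pauliString fun q : {q // q ∈ S} => p q := by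
  ext x y
  simp only [partialTrace, Matrix.of_apply, pauliString_apply_split S, splitBasis_symm_mem,
    splitBasis_symm_notMem, ← Finset.mul_sum, Matrix.smul_apply, smul_eq_mul]
  rw [mul_comm]
  rfl

/-- The partial trace inverts the embedding up to a nonzero factor. -/
theorem embedOp_injective (S : Finset Q) : Function.Injective (embedOp S) := by
  intro M N h
  have := congrArg (partialTrace S) h
  rw [partialTrace_embedOp, partialTrace_embedOp] at this
  exact smul_right_injective _ (pow_ne_zero _ two_ne_zero) this

theorem units_map_embedOp_injective (S : Finset Q) :
    Function.Injective (Units.map (embedOp S)) := fun _ _ h =>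
  Units.ext (embedOp_injective S (congrArg (fun w : (QOp Q)ˣ => (w : QOp Q)) h))

omit [Fintype Q] in
theorem extendLabel_restrict {S : Finset Q} {p : Q → Pauli}
    (h : ∀ q, q ∉ S → p q = Pauli.I) : extendLabel S (fun q => p q) = p := by
  funext q
  by_cases hq : q ∈ S
  · simp [extendLabel, hq]
  · simp [extendLabel, hq, h q hq]

theorem partialTrace_eq_zero_of_label {S : Finset Q} {g : QOp Q} {p : Q → Pauli}
    (hg : EqUpToSign g p) {q : Q} (hq : q ∉ S) (hp : p q ≠ Pauli.I) : partialTrace S g = 0 := by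
  obtain ⟨c, -, rfl⟩ := hg.exists_sign
  rw [partialTrace_smul, partialTrace_pauliString,
    trace_pauliString_eq_zero (q := (⟨q, hq⟩ : {q // q ∉ S})) hp, zero_smul, smul_zero]

/-- A nontrivial label outside `S` would make the partial trace vanish, but it is a nonzero multiple
of the unit `u`. Together with `EqUpToSign.exists_embedOp` this characterizes local stabilizers by
their labels. -/
theorem label_eq_I_of_embedOp {S : Finset Q} {u : (QOp {q // q ∈ S})ˣ} {p : Q → Pauli}
    (h : EqUpToSign (embedOp S u) p) {q : Q} (hq : q ∉ S) : p q = Pauli.I := by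
  by_contra hp
  have := partialTrace_eq_zero_of_label h hq hp
  rw [partialTrace_embedOp] at this
  exact u.ne_zero ((smul_eq_zero.1 this).resolve_left (pow_ne_zero _ two_ne_zero))

theorem EqUpToSign.of_embedOp {S : Finset Q} {u : (QOp {q // q ∈ S})ˣ} {p : Q → Pauli}
    (h : EqUpToSign (embedOp S u) p) : EqUpToSign (u : QOp {q // q ∈ S}) fun q => p q := by
  have e : pauliString p = embedOp S (pauliString fun q : {q // q ∈ S} => p q) := by
    rw [embedOp_pauliString,
      extendLabel_restrict fun q hq => label_eq_I_of_embedOp h hq]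
  rcases h with h | h
  · exact Or.inl (embedOp_injective S (h.trans e))
  · exact Or.inr (embedOp_injective S (by rw [h, e, embedOp_neg]))

/-- The signed Pauli operators on `S` whose extensions by the identity lie in `G`. -/
noncomputable def innerStabilizers (G : Subgroup (QOp Q)ˣ) (S : Finset Q) : Subgroup (QOp {q // q ∈ S})ˣ :=
  G.comap (Units.map (embedOp S))

theorem mem_innerStabilizers {G : Subgroup (QOp Q)ˣ} {S : Finset Q} {u : (QOp {q // q ∈ S})ˣ} :
    u ∈ innerStabilizers G S ↔ Units.map (embedOp S) u ∈ G := Iff.rfl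

theorem map_innerStabilizers (G : Subgroup (QOp Q)ˣ) (S : Finset Q) :
    (innerStabilizers G S).map (Units.map (embedOp S)) = localStabilizers G S := by
  rw [innerStabilizers, Subgroup.map_comap_eq, inf_comm]
  rfl

theorem card_innerStabilizers (G : Subgroup (QOp Q)ˣ) (S : Finset Q) :
    Nat.card (innerStabilizers G S) = Nat.card (localStabilizers G S) := by
  rw [← map_innerStabilizers]
  exact Nat.card_congr
    ((innerStabilizers G S).equivMapOfInjective _ (units_map_embedOp_injective S)).toEquiv

theorem localStabilizers_le (G : Subgroup (QOp Q)ˣ) (S : Finset Q) : localStabilizers G S ≤ G :=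
  inf_le_left

theorem IsStabilizerGroup.inner {G : Subgroup (QOp Q)ˣ} (hG : IsStabilizerGroup G)
    (S : Finset Q) : IsStabilizerGroup (innerStabilizers G S) where
  signedPauli u hu := by
    obtain ⟨p, hp⟩ := hG.signedPauli _ hu
    exact ⟨_, EqUpToSign.of_embedOp hp⟩
  comm u hu v hv := units_map_embedOp_injective S (by
    rw [map_mul, map_mul]
    exact hG.comm _ hu _ hv)
  neg_one_notMem h := hG.neg_one_notMem (by
    have e : Units.map (embedOp S) (-1) = (-1 : (QOp Q)ˣ) := Units.ext (by
      change embedOp S (-1) = -1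
      rw [embedOp_neg, map_one])
    rwa [mem_innerStabilizers, e] at h)

theorem IsStabilizerGroup.label_embedOp {G : Subgroup (QOp Q)ˣ} (hG : IsStabilizerGroup G)
    {S : Finset Q} {u : (QOp {q // q ∈ S})ˣ} (hu : u ∈ innerStabilizers G S)
    (q : {q // q ∈ S}) :
    pauliLabel ((Units.map (embedOp S) u : (QOp Q)ˣ) : QOp Q) q = pauliLabel (u : QOp _) q := by
  obtain ⟨p, hp⟩ := hG.signedPauli _ hu
  rw [pauliLabel_eq hp, pauliLabel_eq (EqUpToSign.of_embedOp hp)]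

theorem IsStabilizerGroup.label_eq_I {G : Subgroup (QOp Q)ˣ} (hG : IsStabilizerGroup G)
    {S : Finset Q} {g : (QOp Q)ˣ} (hg : g ∈ localStabilizers G S) {q : Q} (hq : q ∉ S) :
    pauliLabel (g : QOp Q) q = Pauli.I := by
  obtain ⟨hgG, u, rfl⟩ := hg
  obtain ⟨p, hp⟩ := hG.signedPauli _ hgG
  rw [pauliLabel_eq hp]
  exact label_eq_I_of_embedOp hp hq

theorem EqUpToSign.exists_embedOp {S : Finset Q} {g : (QOp Q)ˣ} {p : Q → Pauli}
    (h : EqUpToSign (g : QOp Q) p) (hp : ∀ q, q ∉ S → p q = Pauli.I) :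
    ∃ u, Units.map (embedOp S) u = g := by
  let σ := pauliString fun q : {q // q ∈ S} => p q
  have hσ : σ * σ = 1 := pauliString_mul_self _
  have e : embedOp S σ = pauliString p := by
    rw [embedOp_pauliString, extendLabel_restrict hp]
  rcases h with h | h
  · exact ⟨⟨σ, σ, hσ, hσ⟩, Units.ext (e.trans h.symm)⟩
  · exact ⟨⟨-σ, -σ, by simp [hσ], by simp [hσ]⟩, Units.ext (by
      change embedOp S (-σ) = _
      rw [embedOp_neg, e, h])⟩

theorem IsStabilizerGroup.partialTrace_signedSum {G : Subgroup (QOp Q)ˣ} [Fintype G]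
    (hG : IsStabilizerGroup G) (S : Finset Q) [Fintype (innerStabilizers G S)] :
    partialTrace S (signedSum G fun _ => 1) = (2 : ℂ) ^ Fintype.card {q // q ∉ S} •
      signedSum (innerStabilizers G S) fun _ => 1 := by
  simp only [signedSum, Units.val_one, Int.cast_one, one_smul, partialTrace_sum, Finset.smul_sum]
  symm
  refine Fintype.sum_of_injective
    (fun u : innerStabilizers G S => (⟨Units.map (embedOp S) u, u.2⟩ : G)) ?_ _ _ ?_ ?_
  · intro u v h
    exact Subtype.ext (units_map_embedOp_injective S (congrArg (fun g : G => (g : (QOp Q)ˣ)) h))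
  · intro g hg
    obtain ⟨p, hp⟩ := hG.signedPauli g g.2
    by_contra h0
    refine hg ?_
    obtain ⟨u, hu⟩ := hp.exists_embedOp (S := S) fun q hq => by
      by_contra hpq
      exact h0 (partialTrace_eq_zero_of_label hp hq hpq)
    exact ⟨⟨u, by rw [mem_innerStabilizers, hu]; exact g.2⟩, Subtype.ext hu⟩
  · intro u
    exact (partialTrace_embedOp S _).symm

omit [Fintype Q] in
theorem partialTranspose_smul (S T : Finset Q) (c : ℂ) (M : QOp {q // q ∈ S}) :
    partialTranspose S T (c • M) = c • partialTranspose S T M := rfl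

omit [Fintype Q] in
theorem partialTranspose_sum (S T : Finset Q) {ι : Type*} (s : Finset ι)
    (M : ι → QOp {q // q ∈ S}) :
    partialTranspose S T (∑ i ∈ s, M i) = ∑ i ∈ s, partialTranspose S T (M i) := by
  ext x y
  simp only [partialTranspose, Matrix.of_apply, Matrix.sum_apply]

omit [Fintype Q] in
-- Partial transposition acts site by site, and only `Y` is antisymmetric.
theorem partialTranspose_pauliString (S T : Finset Q) (p : {q // q ∈ S} → Pauli) :
    partialTranspose S T (pauliString p) =
      (((∏ q ∈ T.subtype (· ∈ S), (p q).transposeSign : ℤˣ) : ℤ) : ℂ) • pauliString p := by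
  ext x y
  simp only [partialTranspose, pauliString, Matrix.of_apply, Matrix.smul_apply, smul_eq_mul]
  have e : (((∏ q ∈ T.subtype (· ∈ S), (p q).transposeSign : ℤˣ) : ℤ) : ℂ) =
      ∏ q, if q.1 ∈ T then (((p q).transposeSign : ℤ) : ℂ) else 1 := by
    rw [← Finset.prod_filter]
    push_cast
    refine Finset.prod_congr ?_ fun _ _ => rfl
    ext q
    simp
  rw [e, ← Finset.prod_mul_distrib]
  refine Finset.prod_congr rfl fun q _ => ?_
  split_ifs
  · exact Pauli.mat_swap_apply _ _ _
  · rw [one_mul]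

omit [Fintype Q] in
theorem IsStabilizerGroup.partialTranspose_signedSum {S : Finset Q}
    {L : Subgroup (QOp {q // q ∈ S})ˣ} [Fintype L] (hL : IsStabilizerGroup L) (T : Finset Q) :
    partialTranspose S T (signedSum L fun _ => 1) =
      signedSum L (transposeSignOn (T.subtype (· ∈ S))) := by
  simp only [signedSum, Units.val_one, Int.cast_one, one_smul, partialTranspose_sum]
  refine Finset.sum_congr rfl fun k _ => ?_
  obtain ⟨p, hp⟩ := hL.signedPauli k k.2
  have key := partialTranspose_pauliString S T (pauliLabel ((k : (QOp {q // q ∈ S})ˣ) : QOp _))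
  obtain ⟨c, -, hc⟩ := hp.exists_sign
  rw [← pauliLabel_eq hp] at hc
  calc partialTranspose S T ((k : (QOp {q // q ∈ S})ˣ) : QOp _)
      = c • partialTranspose S T
          (pauliString (pauliLabel ((k : (QOp {q // q ∈ S})ˣ) : QOp _))) :=
        congrArg (partialTranspose S T) hc
    _ = _ := by
        rw [key, smul_comm, ← hc]
        rfl

end LocalOperators

/-! ### Reduced density matrices, entropies and negativity of a stabilizer state. -/

section StabilizerState
variable {Q : Type*} [Fintype Q] [DecidableEq Q] {G : Subgroup (QOp Q)ˣ} {ψ : QBasis Q → ℂ}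

theorem mul_signedSum_one [Fintype G] {g : (QOp Q)ˣ} (hg : g ∈ G) :
    (g : QOp Q) * signedSum G (fun _ => 1) = signedSum G fun _ => 1 := by
  simp only [signedSum, Units.val_one, Int.cast_one, one_smul, Finset.mul_sum]
  exact Fintype.sum_equiv (Equiv.mulLeft (⟨g, hg⟩ : G)) _ _ fun h => rfl

/-- The density matrix of a stabilizer state is the normalized sum of its stabilizers. -/
theorem IsStabilizerState.signedSum_eq [Fintype G] (hG : IsStabilizerGroup G)
    (hψ : IsStabilizerState G ψ) :
    signedSum G (fun _ => 1) = (2 : ℂ) ^ Fintype.card Q • Matrix.vecMulVec ψ (star ψ) := by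
  set E := signedSum G fun _ => 1 with hE
  have hnorm : ∑ y, star (ψ y) * ψ y = 1 := by
    have := congrArg (fun t : ℝ => (t : ℂ)) hψ.norm_one
    push_cast at this
    rw [← this]
    refine Finset.sum_congr rfl fun y _ => ?_
    rw [← Complex.conj_mul']
    rfl
  -- Every column of `E` is fixed by `G`, hence is a multiple of `ψ` by uniqueness. Hermiticity then
  -- makes `E` a multiple of the projector onto `ψ`, with factor `|G|` because `E` acts on `ψ` by
  -- `|G|`.
  have hcol : ∀ y, ∃ c : ℂ, ∀ x, E x y = c * ψ x := by
    intro y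
    obtain ⟨c, hc⟩ := hψ.unique (E.mulVec (Pi.single y 1)) fun g hg => by
      rw [Matrix.mulVec_mulVec, mul_signedSum_one hg]
    refine ⟨c, fun x => ?_⟩
    have := congrFun hc x
    rwa [Matrix.mulVec_single_one] at this
  choose c hc using hcol
  have hherm : ∀ x y, E x y = star (c x) * star (ψ y) := by
    intro x y
    have := congrFun (congrFun (hG.signedSum_conjTranspose fun _ => 1) x) y
    rw [Matrix.conjTranspose_apply] at this
    rw [hE, ← this, ← hE, hc, star_mul']
  have hEψ : E.mulVec ψ = (Fintype.card G : ℂ) • ψ := by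
    simp only [hE, signedSum, Units.val_one, Int.cast_one, one_smul, Matrix.sum_mulVec]
    rw [Finset.sum_congr rfl fun g _ => hψ.fixed _ (Subtype.prop g)]
    simp [← Nat.cast_smul_eq_nsmul ℂ]
  have hcx : ∀ x, star (c x) = Fintype.card G * ψ x := by
    intro x
    have := congrFun hEψ x
    simp only [Matrix.mulVec, dotProduct, hherm, mul_assoc, ← Finset.mul_sum, hnorm, mul_one,
      Pi.smul_apply, smul_eq_mul] at this
    exact this
  have hEq : E = (Fintype.card G : ℂ) • Matrix.vecMulVec ψ (star ψ) := by
    ext x y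
    rw [hherm, hcx, Matrix.smul_apply, Matrix.vecMulVec_apply, smul_eq_mul, mul_assoc]
    rfl
  -- Only the identity has nonzero trace; comparing traces gives `|G| = 2 ^ N` without a separate
  -- count of generators.
  have htr := hG.trace_signedSum (t := fun _ => 1) rfl
  rw [← hE, hEq, Matrix.trace_smul, Matrix.trace_vecMulVec, dotProduct_comm] at htr
  have : star ψ ⬝ᵥ ψ = 1 := hnorm
  rw [this, smul_eq_mul, mul_one] at htr
  rw [hEq, htr]

theorem IsStabilizerState.reducedDensity_eq (hG : IsStabilizerGroup G)
    (hψ : IsStabilizerState G ψ) (S : Finset Q) [Fintype (innerStabilizers G S)] :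
    reducedDensity S ψ =
      ((2 : ℂ) ^ S.card)⁻¹ • signedSum (innerStabilizers G S) fun _ => 1 := by
  have := hG.finite
  have := Fintype.ofFinite G
  have h1 := congrArg (partialTrace S) (hψ.signedSum_eq hG)
  rw [hG.partialTrace_signedSum, partialTrace_smul] at h1
  have hN : Fintype.card Q = S.card + Fintype.card {q // q ∉ S} := by
    rw [← Fintype.card_coe S, ← Fintype.card_sum]
    exact Fintype.card_congr (Equiv.sumCompl (fun q => q ∈ S)).symm
  have h2 : (2 : ℂ) ^ Fintype.card {q // q ∉ S} ≠ 0 := pow_ne_zero _ two_ne_zero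
  rw [hN, pow_add, mul_comm, mul_smul] at h1
  rw [smul_right_injective _ h2 h1, smul_smul, inv_mul_cancel₀ (pow_ne_zero _ two_ne_zero),
    one_smul]
  rfl

/-- The Rényi entropies of a stabilizer state are all equal. -/
theorem IsStabilizerState.renyiEntropy_eq (hG : IsStabilizerGroup G)
    (hψ : IsStabilizerState G ψ) (S : Finset Q) (m : ℝ) :
    renyiEntropy m (reducedDensity S ψ) =
      S.card - Real.logb 2 (Nat.card (localStabilizers G S)) := by
  have hL := hG.inner S
  have := hL.finite
  have := Fintype.ofFinite (innerStabilizers G S)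
  obtain ⟨P, hP, hP', hsum, htr⟩ := hL.signedSum_projection (t := fun _ => 1) (by simp)
  have hn : (0 : ℝ) < Fintype.card (innerStabilizers G S) := by
    exact_mod_cast Fintype.card_pos
  have h2 : (0 : ℝ) < 2 ^ S.card := by positivity
  have e : reducedDensity S ψ =
      ((Fintype.card (innerStabilizers G S) : ℝ) / 2 ^ S.card) • P := by
    rw [hψ.reducedDensity_eq hG, hsum]
    ext i j
    simp
    ring
  rw [e, renyiEntropy_smul_projection hP hP' (by positivity)
    (by rw [htr, Fintype.card_coe, inv_div])]
  rw [Real.logb_div hn.ne' h2.ne', Real.logb_pow, Real.logb_self_eq_one one_lt_two,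
    ← card_innerStabilizers, Nat.card_eq_fintype_card]
  ring

theorem IsStabilizerGroup.isSignForm (hG : IsStabilizerGroup G) (S : Finset Q) :
    IsSignForm G (commSignOn S) :=
  ⟨fun _ hg _ hh k _ => hG.commSignOn_mul_left S hg hh k, commSignOn_symm S, commSignOn_self S⟩

theorem IsStabilizerGroup.commSignOn_embedOp (hG : IsStabilizerGroup G) {S T : Finset Q}
    (hT : T ⊆ S) {u v : (QOp {q // q ∈ S})ˣ} (hu : u ∈ innerStabilizers G S)
    (hv : v ∈ innerStabilizers G S) :
    commSignOn T (Units.map (embedOp S) u) (Units.map (embedOp S) v) =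
      commSignOn (T.subtype (· ∈ S)) u v := by
  unfold commSignOn
  rw [← Finset.prod_subtype_of_mem _ (p := (· ∈ S)) fun q hq => hT hq]
  exact Finset.prod_congr rfl fun q _ => by
    rw [hG.label_embedOp hu, hG.label_embedOp hv]

/-- The partial-transpose negativity of a stabilizer state, in terms of the radical `R` of the
commutation form on the restrictions to `A₂`. -/
theorem IsStabilizerState.ptNegativity_eq (hG : IsStabilizerGroup G)
    (hψ : IsStabilizerState G ψ) (A₁ A₂ : Finset Q) {R : Subgroup (QOp Q)ˣ} {s : ℕ}
    (hRL : R ≤ localStabilizers G (A₁ ∪ A₂))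
    (hR : ∀ k ∈ localStabilizers G (A₁ ∪ A₂),
      k ∈ R ↔ ∀ g ∈ localStabilizers G (A₁ ∪ A₂), commSignOn A₂ g k = 1)
    (hcard : Nat.card R * 2 ^ (2 * s) = Nat.card (localStabilizers G (A₁ ∪ A₂))) :
    ptNegativity A₁ A₂ ψ = s := by
  unfold ptNegativity
  set S := A₁ ∪ A₂ with hS
  have hTS : A₂ ⊆ S := Finset.subset_union_right
  set L := innerStabilizers G S with hLdef
  have hL : IsStabilizerGroup L := hG.inner S
  have := hL.finite
  have := Fintype.ofFinite L
  set T := A₂.subtype (· ∈ S) with hT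
  let R' := R.comap (Units.map (embedOp S))
  have hmemL : ∀ u, u ∈ L ↔ Units.map (embedOp S) u ∈ localStabilizers G S := fun u =>
    ⟨fun h => ⟨h, u, rfl⟩, fun h => h.1⟩
  have hR'L : R' ≤ L := fun u hu => (hRL hu).1
  have : Finite R' := Finite.of_injective _ (Subgroup.inclusion_injective hR'L)
  have := Fintype.ofFinite R'
  have hR' : ∀ k ∈ L, k ∈ R' ↔ ∀ g ∈ L, commSignOn T g k = 1 := by
    intro k hk
    refine (hR _ ((hmemL k).1 hk)).trans ⟨fun h g hg => ?_, ?_⟩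
    · rw [hT, ← hG.commSignOn_embedOp hTS hg hk]
      exact h _ ((hmemL g).1 hg)
    · rintro h _ ⟨hg, u, rfl⟩
      rw [hG.commSignOn_embedOp hTS hg hk]
      exact h u hg
  have hcardR : Nat.card R' = Nat.card R := by
    have hmap : R'.map (Units.map (embedOp S)) = R := by
      rw [Subgroup.map_comap_eq, inf_eq_right]
      exact fun g hg => (hRL hg).2
    rw [← hmap]
    exact Nat.card_congr (R'.equivMapOfInjective _ (units_map_embedOp_injective S)).toEquiv
  have hform := hL.isSignForm T
  have ht : ∀ g ∈ L, ∀ h ∈ L, transposeSignOn T (g * h) =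
      transposeSignOn T g * transposeSignOn T h * commSignOn T g h := fun g hg h hh =>
    hL.transposeSignOn_mul T hg hh
  have hsq := signedSum_mul_signedSum L R' hR'L (transposeSignOn T) (commSignOn T) ht
    hform.mul_left hform.mul_right (fun g _ => hform.self g) hR'
  obtain ⟨P, hP, hP', hsum, htr⟩ := (hL.mono hR'L).signedSum_projection (t := transposeSignOn T)
    fun g hg h hh => by
      rw [ht g (hR'L hg) h (hR'L hh), (hR' h (hR'L hh)).1 hh g (hR'L hg), mul_one]
  rw [hψ.reducedDensity_eq hG, partialTranspose_smul, hL.partialTranspose_signedSum, ← hT]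
  have hcard' : (Fintype.card L : ℝ) = Fintype.card R' * (2 ^ s) ^ 2 := by
    rw [← Nat.card_eq_fintype_card, ← Nat.card_eq_fintype_card, hcardR, card_innerStabilizers,
      ← hcard]
    push_cast
    ring
  have hn : (0 : ℝ) < Fintype.card R' := by exact_mod_cast Fintype.card_pos
  have h2 : (2 : ℝ) ^ S.card ≠ 0 := by positivity
  -- The square of the transposed density matrix is `4^(-|S|) * |L| * |R'|` times `P`; with `|L| =
  -- |R'| * 4^s` the square root of this factor is `c`.
  rw [traceNorm_eq_of_conjTranspose_mul hP hP' (c := Fintype.card R' * 2 ^ s / 2 ^ S.card)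
    (by positivity)]
  · rw [htr, Complex.ofReal_re, Fintype.card_coe]
    have : (Fintype.card R' : ℝ) * 2 ^ s / 2 ^ S.card * (2 ^ S.card / Fintype.card R') = 2 ^ s := by
      field_simp
    rw [this, Real.logb_pow, Real.logb_self_eq_one one_lt_two, mul_one]
  · rw [Matrix.conjTranspose_smul, hL.signedSum_conjTranspose, Matrix.smul_mul, Matrix.mul_smul,
      hsq, hsum]
    have hc2 : (Fintype.card L : ℂ) = Fintype.card R' * (2 ^ s) ^ 2 := by exact_mod_cast hcard'
    rw [hc2]
    ext i j
    simp
    ring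

end StabilizerState

/-! ### Canonical generators as symplectic families. -/

section Canonical
variable {Q : Type*} [Fintype Q] [DecidableEq Q] {G : Subgroup (QOp Q)ˣ}

theorem IsStabilizerGroup.commute_iff (hG : IsStabilizerGroup G) (S : Finset Q) (g : (QOp Q)ˣ)
    {h : (QOp Q)ˣ} (hh : h ∈ G) :
    Commute (pauliRestrict S (g : QOp Q)) (h : QOp Q) ↔ commSignOn S g h = 1 := by
  obtain ⟨p, hp⟩ := hG.signedPauli h hh
  exact commute_pauliRestrict_iff S g h hp

theorem IsStabilizerGroup.disjoint_localStabilizers (hG : IsStabilizerGroup G) {A₁ A₂ : Finset Q}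
    (hA : Disjoint A₁ A₂) : Disjoint (localStabilizers G A₁) (localStabilizers G A₂) := by
  rw [Subgroup.disjoint_def]
  intro g h1 h2
  refine hG.eq_one_of_label (localStabilizers_le G _ h1) fun q => ?_
  by_cases hq : q ∈ A₁
  · exact hG.label_eq_I h2 (Finset.disjoint_left.1 hA hq)
  · exact hG.label_eq_I h1 hq

theorem localStabilizers_mono (hG : IsStabilizerGroup G) {S T : Finset Q} (h : S ⊆ T) :
    localStabilizers G S ≤ localStabilizers G T := by
  intro g hg
  have hgG := localStabilizers_le G _ hg
  obtain ⟨p, hp⟩ := hG.signedPauli g hgG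
  refine ⟨hgG, hp.exists_embedOp fun q hq => ?_⟩
  rw [← pauliLabel_eq hp]
  exact hG.label_eq_I hg fun h' => hq (h h')

/-- Stabilizers inside `A₁` or inside `A₂` are in the radical of the commutation form. -/
theorem IsStabilizerGroup.commSignOn_eq_one (hG : IsStabilizerGroup G) {A₁ A₂ : Finset Q}
    (hA : Disjoint A₁ A₂) {g : (QOp Q)ˣ}
    (hg : g ∈ localStabilizers G A₁ ⊔ localStabilizers G A₂) {h : (QOp Q)ˣ} (hh : h ∈ G) :
    commSignOn A₂ g h = 1 := by
  have hform := hG.isSignForm A₂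
  have hle : localStabilizers G A₁ ⊔ localStabilizers G A₂ ≤ hform.orthogonal hh := by
    refine sup_le (fun x hx => ⟨localStabilizers_le G _ hx, ?_⟩)
      (fun x hx => ⟨localStabilizers_le G _ hx, ?_⟩)
    · refine Finset.prod_eq_one fun q hq => ?_
      rw [hG.label_eq_I hx (Finset.disjoint_right.1 hA hq), Pauli.commSign_I_left]
    -- A stabilizer inside `A₂` is its own restriction up to sign, so its commutation sign on `A₂`
    -- is trivial because `G` is abelian.
    · rw [← hG.commute_iff A₂ x hh]
      have hxG := localStabilizers_le G _ hx
      obtain ⟨p, hp⟩ := hG.signedPauli x hxG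
      have e : pauliRestrict A₂ (x : QOp Q) = pauliString (pauliLabel (x : QOp Q)) := by
        unfold pauliRestrict
        congr 1
        funext q
        split_ifs with hq
        · rfl
        · exact (hG.label_eq_I hx hq).symm
      have hc : Commute (x : QOp Q) (h : QOp Q) :=
        congrArg (fun u : (QOp Q)ˣ => (u : QOp Q)) (hG.comm x hxG h hh)
      rw [e]
      rcases hp.eq_or with h1 | h1
      · rwa [← h1]
      · rw [← neg_eq_iff_eq_neg.2 h1]
        exact hc.neg_left
  exact (hle hg).2

theorem IsSymplecticFamily.isCanonicalGenerators (hG : IsStabilizerGroup G) {A₂ : Finset Q}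
    {G₁₂ : Subgroup (QOp Q)ˣ} (hle : G₁₂ ≤ G) {r s : ℕ} {z : Fin r → (QOp Q)ˣ}
    {w wbar : Fin s → (QOp Q)ˣ}
    (hgen : Subgroup.closure (Set.range z ∪ Set.range w ∪ Set.range wbar) = G₁₂)
    (hcard : Nat.card G₁₂ = 2 ^ (r + 2 * s))
    (hf : IsSymplecticFamily (commSignOn A₂) z w wbar) :
    IsCanonicalGenerators A₂ G₁₂ z w wbar := by
  have hmem : ∀ g ∈ Set.range z ∪ Set.range w ∪ Set.range wbar, g ∈ G := fun g hg =>
    hle (hgen ▸ Subgroup.subset_closure hg)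
  have hsymm := commSignOn_symm A₂
  have hne : (-1 : ℤˣ) ≠ 1 := by decide
  have hwb : ∀ i j, commSignOn A₂ (wbar i) (w j) = if i = j then -1 else 1 := fun i j => by
    rw [hsymm, hf.w_wbar]
    simp only [eq_comm]
  refine ⟨hgen, hcard, fun i g hg => ?_, fun j g hg => ?_, fun j g hg => ?_⟩ <;>
    rw [hG.commute_iff A₂ _ (hmem g hg)]
  · rcases hg with (⟨k, rfl⟩ | ⟨k, rfl⟩) | ⟨k, rfl⟩
    exacts [hf.z_z i k, hf.z_w i k, hf.z_wbar i k]
  · constructor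
    · rintro h rfl
      rw [hf.w_wbar, if_pos rfl] at h
      exact hne h
    · intro h
      rcases hg with (⟨k, rfl⟩ | ⟨k, rfl⟩) | ⟨k, rfl⟩
      · rw [hsymm, hf.z_w]
      · exact hf.w_w j k
      · rw [hf.w_wbar, if_neg]
        rintro rfl
        exact h rfl
  · constructor
    · rintro h rfl
      rw [hwb, if_pos rfl] at h
      exact hne h
    · intro h
      rcases hg with (⟨k, rfl⟩ | ⟨k, rfl⟩) | ⟨k, rfl⟩
      · rw [hsymm, hf.z_wbar]
      · rw [hwb, if_neg]
        rintro rfl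
        exact h rfl
      · exact hf.wbar_wbar j k

/-- `IsCanonicalGenerators` compares generators as group elements, `IsSymplecticFamily` compares
indices. The two agree because the order `2 ^ (r + 2 * s)` forces the generators to be distinct. -/
theorem IsCanonicalGenerators.isSymplecticFamily (hG : IsStabilizerGroup G) {A₂ : Finset Q}
    {G₁₂ : Subgroup (QOp Q)ˣ} (hle : G₁₂ ≤ G) {r s : ℕ} {z : Fin r → (QOp Q)ˣ}
    {w wbar : Fin s → (QOp Q)ˣ} (hc : IsCanonicalGenerators A₂ G₁₂ z w wbar) :
    IsSymplecticFamily (commSignOn A₂) z w wbar := by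
  have : Finite G₁₂ := (hG.mono hle).finite
  have hmem : ∀ g ∈ Set.range z ∪ Set.range w ∪ Set.range wbar, g ∈ G := fun g hg =>
    hle (hc.generate ▸ Subgroup.subset_closure hg)
  have hz : ∀ i, z i ∈ Set.range z ∪ Set.range w ∪ Set.range wbar := fun i =>
    Or.inl (Or.inl ⟨i, rfl⟩)
  have hw : ∀ i, w i ∈ Set.range z ∪ Set.range w ∪ Set.range wbar := fun i =>
    Or.inl (Or.inr ⟨i, rfl⟩)
  have hwb : ∀ i, wbar i ∈ Set.range z ∪ Set.range w ∪ Set.range wbar := fun i =>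
    Or.inr ⟨i, rfl⟩
  have hinj : Function.Injective (Sum.elim (Sum.elim z w) wbar) := by
    refine injective_of_card_closure_range (L := G₁₂) (fun g hg => hG.mul_self (hle hg)) _ ?_ ?_
    · rw [Set.Sum.elim_range, Set.Sum.elim_range, hc.generate]
    · rw [hc.independent]
      congr 1
      simp
      ring
  refine ⟨fun i j => ?_, fun i j => ?_, fun i j => ?_, fun i j => ?_, fun i j => ?_,
    fun i j => ?_⟩
  · exact (hG.commute_iff A₂ _ (hmem _ (hz j))).1 (hc.z_comm i _ (hz j))
  · exact (hG.commute_iff A₂ _ (hmem _ (hw j))).1 (hc.z_comm i _ (hw j))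
  · exact (hG.commute_iff A₂ _ (hmem _ (hwb j))).1 (hc.z_comm i _ (hwb j))
  · refine (hG.commute_iff A₂ _ (hmem _ (hw j))).1 ((hc.w_comm i _ (hw j)).2 fun h => ?_)
    have := @hinj (Sum.inl (Sum.inr j)) (Sum.inr i) h
    simp at this
  · refine (hG.commute_iff A₂ _ (hmem _ (hwb j))).1 ((hc.wbar_comm i _ (hwb j)).2 fun h => ?_)
    have := @hinj (Sum.inr j) (Sum.inl (Sum.inr i)) h
    simp at this
  · have key := (hG.commute_iff A₂ (w i) (hmem _ (hwb j))).symm.trans (hc.w_comm i _ (hwb j))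
    split_ifs with hij
    · subst hij
      exact (Int.units_eq_one_or _).resolve_left fun h => key.1 h rfl
    · refine key.2 fun h => hij ?_
      have := @hinj (Sum.inr j) (Sum.inr i) h
      simpa [eq_comm] using this

end Canonical

/-! ### The main theorem. -/

theorem theorem3 {Q : Type*} [Fintype Q] [DecidableEq Q]
    (G : Subgroup (QOp Q)ˣ) (hG : IsStabilizerGroup G)
    (ψ : QBasis Q → ℂ) (hψ : IsStabilizerState G ψ)
    (A₁ A₂ : Finset Q) (hA : Disjoint A₁ A₂) :
    (∃ G₁₂ : Subgroup (QOp Q)ˣ, IsCrossSubgroup G A₁ A₂ G₁₂) ∧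
    (∀ G₁₂ : Subgroup (QOp Q)ˣ, IsCrossSubgroup G A₁ A₂ G₁₂ →
      ∃ (r s : ℕ) (z : Fin r → (QOp Q)ˣ) (w wbar : Fin s → (QOp Q)ˣ),
        IsCanonicalGenerators A₂ G₁₂ z w wbar) ∧
    (∀ (G₁₂ : Subgroup (QOp Q)ˣ) (r s : ℕ)
      (z : Fin r → (QOp Q)ˣ) (w wbar : Fin s → (QOp Q)ˣ),
      IsCrossSubgroup G A₁ A₂ G₁₂ → IsCanonicalGenerators A₂ G₁₂ z w wbar →
      ptNegativity A₁ A₂ ψ = s ∧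
      ∀ m : ℝ, 0 ≤ m → (s : ℝ) = (mutualInfo m A₁ A₂ ψ - r) / 2) := by
  have hAG := localStabilizers_le G (A₁ ∪ A₂)
  have hsq : ∀ g ∈ G, g * g = 1 := fun g hg => hG.mul_self hg
  have hcross : ∀ G₁₂, IsCrossSubgroup G A₁ A₂ G₁₂ → G₁₂ ≤ G := fun G₁₂ h =>
    (le_sup_right.trans h.generate.le).trans hAG
  refine ⟨?_, fun G₁₂ hc => ?_, fun G₁₂ r s z w wbar hc hcan => ?_⟩
  · have : Finite (localStabilizers G (A₁ ∪ A₂)) := (hG.mono hAG).finite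
    obtain ⟨H, -, hd, hs⟩ := exists_disjoint_sup_eq (fun g hg => hsq g (hAG hg))
      (sup_le (localStabilizers_mono hG (Finset.subset_union_left (s₂ := A₂)))
        (localStabilizers_mono hG (Finset.subset_union_right (s₁ := A₁))))
    exact ⟨H, hs, hd⟩
  · have : Finite G₁₂ := (hG.mono (hcross _ hc)).finite
    obtain ⟨r, s, z, w, wbar, hgen, hcard, hf⟩ := exists_symplectic_generators (commSignOn A₂) _
      G₁₂ (fun g hg => hsq g (hcross _ hc hg)) ((hG.isSignForm A₂).mono (hcross _ hc)) le_rfl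
    exact ⟨r, s, z, w, wbar, hf.isCanonicalGenerators hG (hcross _ hc) hgen hcard⟩
  · constructor
    · obtain ⟨R, hRL, hR, hcard⟩ := exists_radical
        (L := localStabilizers G (A₁ ∪ A₂)) (K := localStabilizers G A₁ ⊔ localStabilizers G A₂)
        ((hG.isSignForm A₂).mono hAG) (hcan.isSymplecticFamily hG (hcross _ hc))
        (fun g hg h hh => hG.commSignOn_eq_one hA hg (hAG hh))
        (by rw [hcan.generate, hc.generate])
      exact hψ.ptNegativity_eq hG A₁ A₂ hRL hR hcard
    · intro m _
      have hcomm : ∀ {H K : Subgroup (QOp Q)ˣ}, H ≤ G → K ≤ G → ∀ a ∈ H, ∀ b ∈ K, Commute a b :=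
        fun hH hK a ha b hb => hG.comm a (hH ha) b (hK hb)
      have h1 := localStabilizers_le G A₁
      have h2 := localStabilizers_le G A₂
      -- In the mutual information the qubit numbers cancel, leaving the logarithm of `|G_A| /
      -- (|G_{A₁}| |G_{A₂}|)`, which is `r + 2 * s` whatever `m` is.
      have hcard : (Nat.card (localStabilizers G (A₁ ∪ A₂)) : ℝ) =
          Nat.card (localStabilizers G A₁) * Nat.card (localStabilizers G A₂) *
            2 ^ (r + 2 * s) := by
        rw [← hc.generate, Subgroup.card_sup_of_disjoint
          (hcomm (sup_le h1 h2) (hcross _ hc)) hc.independent,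
          Subgroup.card_sup_of_disjoint (hcomm h1 h2) (hG.disjoint_localStabilizers hA),
          hcan.independent]
        push_cast
        rfl
      have := (hG.mono h1).finite
      have := (hG.mono h2).finite
      have hp1 : (Nat.card (localStabilizers G A₁) : ℝ) ≠ 0 := by exact_mod_cast Nat.card_pos.ne'
      have hp2 : (Nat.card (localStabilizers G A₂) : ℝ) ≠ 0 := by exact_mod_cast Nat.card_pos.ne'
      rw [mutualInfo, hψ.renyiEntropy_eq hG, hψ.renyiEntropy_eq hG, hψ.renyiEntropy_eq hG, hcard,
        Real.logb_mul (mul_ne_zero hp1 hp2) (by positivity), Real.logb_mul hp1 hp2, Real.logb_pow,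
        Real.logb_self_eq_one one_lt_two, Finset.card_union_of_disjoint hA]
      push_cast
      ring
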